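/- Fix an integer $r\ge 1$. Let $\boldsymbol m=(m_1,\dots,m_r)$, $\boldsymbol l=(l_1,\dots,l_r)$ be sequences of non-negative integers and $k$ a non-negative integer; put $l_0=k$, $l_{r+1}=0$. The parameters $\boldsymbol m,\boldsymbol l,k$ are called consistent if $k\ge l_1\ge\dots\ge l_r\ge 0$ and $l_s-l_{s+1}\le m_s$ for $s=1,\dots,r$. For a finite-dimensional space $S\subset\mathbb C[x]$, the exponents of $S$ at $z\in\mathbb C$ are the orders of vanishing at $z$ of the nonzero elements of $S$, the exponents at $\infty$ are the degrees of the nonzero elements of $S$, and the singular points of $S$ are the roots of the Wronskian of a basis of $S$. There are $\dim S$ exponents at each point. If $\dim S=r+1$ and $d_0<\dots<d_r$ are the exponents at $z$, let $F_i(S,z)$ be the $i$-dimensional subspace of the elements of $S$ vanishing at $z$ to order at least $d_{r+1-i}$; if $e_0<\dots<e_r$ are the exponents at $\infty$, let $F_i(S,\infty)$ be the $i$-dimensional subspace of the elements of $S$ of degree at most $e_{i-1}$ ($i=1,\dots,r$). For consistent $\boldsymbol m,\boldsymbol l,k$, let $V(\boldsymbol m,\boldsymbol l,k)$ be the $(r+1)$-dimensional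 space of polynomials without base points, with no singular points other than $0$ and $1$, and with exponents $$\textstyle \{i+\sum_{s=1}^i m_s\}\ \text{at } 0,\qquad \{0,k+1,k+2,\dots,k+r\}\ \text{at } 1,\qquad \{k+\sum_{s=1}^{i}m_s-l_i+l_{i+1}+i\}\ \text{at }\infty,$$ and let $U(\boldsymbol m,\boldsymbol l,k)$ be the $(r+1)$-dimensional space of polynomials without base points, with no singular points other than $0$ and $1$, and with exponents $$\textstyle \{i+\sum_{s=r+1-i}^r m_s\}\ \text{at } 0,\qquad \{0,1,\dots,r-1,r+k\}\ \text{at } 1,\qquad \{\sum_{s=r+1-i}^{r}m_s-l_{r-i+1}+l_{r-i}+i\}\ \text{at }\infty,$$ where $i=0,\dots,r$ in each set. Theorem. Let $\boldsymbol m,\boldsymbol l_1,k_1$ and $\boldsymbol m,\boldsymbol l_2,k_2$ be consistent parameters. Write $V_j=V(\boldsymbol m,\boldsymbol l_j,k_j)$ and $U_j=U(\boldsymbol m,\boldsymbol l_j,k_j)$, $j=1,2$; each of these spaces exists and is unique. (1) There is a linear isomorphism $a:V_1\to V_2$ such that $a(F_i(V_1,0))=F_i(V_2,0)$ and $a(F_i(V_1,\infty))=F_i(V_2,\infty)$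 for $i=1,\dots,r$, and $a(F_r(V_1,1))=F_r(V_2,1)$. Any two such isomorphisms differ by multiplication by a non-zero complex number. (2) There is a linear isomorphism $b:U_1\to U_2$ such that $b(F_i(U_1,0))=F_i(U_2,0)$ and $b(F_i(U_1,\infty))=F_i(U_2,\infty)$ for $i=1,\dots,r$, and $b(F_1(U_1,1))=F_1(U_2,1)$. Any two such isomorphisms differ by multiplication by a non-zero complex number. -/

import Mathlib

open Polynomial

namespace TwoPointSpaces

/-- The sequence `l₁, …, l_r` extended by `l₀ = k` and `l_{r+1} = 0`
(the entry `l i` of a family over `Fin r` is the number `l_{i+1}`). -/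
def extL {r : ℕ} (l : Fin r → ℕ) (k : ℕ) : ℕ → ℕ
  | 0 => k
  | s + 1 => if h : s < r then l ⟨s, h⟩ else 0

/-- Consistency: `k ≥ l₁ ≥ … ≥ l_r ≥ 0` and `l_s - l_{s+1} ≤ m_s` for `s = 1, …, r`. -/
def Consistent {r : ℕ} (m l : Fin r → ℕ) (k : ℕ) : Prop :=
  (∀ s : Fin r, extL l k (s + 1) ≤ extL l k s) ∧
  (∀ s : Fin r, extL l k (s + 1) ≤ extL l k (s + 2) + m s)

/-- The number `j + n₁ + ⋯ + n_j`. -/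
def expo {r : ℕ} (n : Fin r → ℕ) (j : ℕ) : ℕ :=
  j + ∑ s : Fin r with s.val < j, n s

/-- The orders of zero at `z` of the nonzero elements of `V`: the exponents of `V` at `z`. -/
def exponentsAt (V : Submodule ℂ ℂ[X]) (z : ℂ) : Set ℕ :=
  {d | ∃ f ∈ V, f ≠ 0 ∧ f.rootMultiplicity z = d}

/-- The degrees of the nonzero elements of `V`: the exponents of `V` at infinity. -/
def exponentsAtInfty (V : Submodule ℂ ℂ[X]) : Set ℕ :=
  {d | ∃ f ∈ V, f ≠ 0 ∧ f.natDegree = d}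

/-- The Wronskian determinant `det (d^i f_j / dx^i)`. -/
noncomputable def wronskianDet {N : ℕ} (f : Fin N → ℂ[X]) : ℂ[X] :=
  Matrix.det (Matrix.of fun i j : Fin N => derivative^[(i : ℕ)] (f j))

/-- `z` is a singular point of `V` if it is a root of the Wronskian of a basis of `V` (any two
bases have proportional Wronskians). -/
def IsSingularPoint (V : Submodule ℂ ℂ[X]) (z : ℂ) : Prop :=
  ∃ (N : ℕ) (b : Module.Basis (Fin N) ℂ V), (wronskianDet fun j => (b j : ℂ[X])).IsRoot z

/-- `V` is an `(r+1)`-dimensional space of polynomials without base points, without singular points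
other than `0` and `1`, and with exponents `expo n₀ j` at `0`, `expo n₁ j` at `1` and `e j` at
infinity, `j = 0, …, r`. -/
structure IsTwoPointSpace (r : ℕ) (n₀ n₁ : Fin r → ℕ) (e : ℕ → ℕ) (V : Submodule ℂ ℂ[X]) :
    Prop where
  finite : Module.Finite ℂ V
  finrank_eq : Module.finrank ℂ V = r + 1
  no_base_point : ∀ z : ℂ, ∃ f ∈ V, f.eval z ≠ 0
  singular : ∀ z : ℂ, IsSingularPoint V z → z = 0 ∨ z = 1
  exponents_zero : exponentsAt V 0 = expo n₀ '' Set.Iic r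
  exponents_one : exponentsAt V 1 = expo n₁ '' Set.Iic r
  exponents_infty : exponentsAtInfty V = e '' Set.Iic r

/-- `(k, 0, …, 0)`. -/
def firstK (r k : ℕ) : Fin r → ℕ := fun i => if i.val = 0 then k else 0

/-- `(0, …, 0, k)`. -/
def lastK (r k : ℕ) : Fin r → ℕ := fun i => if i.val + 1 = r then k else 0

/-- `m` read backwards: the `i`-th entry is `m_{r+1-i}`. -/
def revM {r : ℕ} (m : Fin r → ℕ) : Fin r → ℕ := fun i => m i.rev

/-- `e_i = k + ∑_{s=1}^i m_s - l_i + l_{i+1} + i` for `i = 0, …, r`. For consistent parameters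
`l_i ≤ k`, so that the subtraction is not truncated. -/
def degV {r : ℕ} (m l : Fin r → ℕ) (k : ℕ) (i : ℕ) : ℕ :=
  expo m i + (k - extL l k i) + extL l k (i + 1)

/-- `e_i^∨ = ∑_{s=r+1-i}^r m_s - l_{r-i+1} + l_{r-i} + i` for `i = 0, …, r`. For consistent
parameters `l_{r-i+1} ≤ l_{r-i}`, so that the subtraction is not truncated. -/
def degU {r : ℕ} (m l : Fin r → ℕ) (k : ℕ) (i : ℕ) : ℕ :=
  expo (revM m) i + (extL l k (r - i) - extL l k (r - i + 1))

/-- `S` is the space `V(m, l, k)`. -/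
def IsSpaceV {r : ℕ} (m l : Fin r → ℕ) (k : ℕ) (S : Submodule ℂ ℂ[X]) : Prop :=
  IsTwoPointSpace r m (firstK r k) (degV m l k) S

/-- `S` is the space `U(m, l, k)`. -/
def IsSpaceU {r : ℕ} (m l : Fin r → ℕ) (k : ℕ) (S : Submodule ℂ ℂ[X]) : Prop :=
  IsTwoPointSpace r (revM m) (lastK r k) (degU m l k) S

/-- The term `F_i(z)` of the flag at `z` of a space `V` whose exponents at `z` are
`expo n 0, …, expo n r`: the elements vanishing at `z` to order at least `expo n (r + 1 - i)`. -/
noncomputable def flagAt {r : ℕ} (V : Submodule ℂ ℂ[X]) (z : ℂ) (n : Fin r → ℕ) (i : ℕ) :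
    Submodule ℂ V :=
  ((Ideal.span {(X - C z) ^ expo n (r + 1 - i)}).restrictScalars ℂ).comap V.subtype

/-- The term `F_i(∞)`, `i ≥ 1`, of the flag at infinity of a space `V` whose exponents at infinity
are `e 0 < ⋯ < e r`: the elements of degree at most `e (i - 1)`. -/
noncomputable def flagAtInfty (V : Submodule ℂ ℂ[X]) (e : ℕ → ℕ) (i : ℕ) : Submodule ℂ V :=
  (degreeLE ℂ (e (i - 1) : WithBot ℕ)).comap V.subtype

/-- Canonical maps `V(m, l₁, k₁) → V(m, l₂, k₂)`. -/
structure IsCanonicalV {r : ℕ} (m l₁ : Fin r → ℕ) (k₁ : ℕ) (l₂ : Fin r → ℕ) (k₂ : ℕ)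
    {V₁ V₂ : Submodule ℂ ℂ[X]} (a : V₁ →ₗ[ℂ] V₂) : Prop where
  bijective : Function.Bijective a
  map_zero : ∀ i ∈ Finset.Icc 1 r, (flagAt V₁ 0 m i).map a = flagAt V₂ 0 m i
  map_infty : ∀ i ∈ Finset.Icc 1 r,
    (flagAtInfty V₁ (degV m l₁ k₁) i).map a = flagAtInfty V₂ (degV m l₂ k₂) i
  map_one : (flagAt V₁ 1 (firstK r k₁) r).map a = flagAt V₂ 1 (firstK r k₂) r

/-- Canonical maps `U(m, l₁, k₁) → U(m, l₂, k₂)`. -/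
structure IsCanonicalU {r : ℕ} (m l₁ : Fin r → ℕ) (k₁ : ℕ) (l₂ : Fin r → ℕ) (k₂ : ℕ)
    {U₁ U₂ : Submodule ℂ ℂ[X]} (b : U₁ →ₗ[ℂ] U₂) : Prop where
  bijective : Function.Bijective b
  map_zero : ∀ i ∈ Finset.Icc 1 r, (flagAt U₁ 0 (revM m) i).map b = flagAt U₂ 0 (revM m) i
  map_infty : ∀ i ∈ Finset.Icc 1 r,
    (flagAtInfty U₁ (degU m l₁ k₁) i).map b = flagAtInfty U₂ (degU m l₂ k₂) i
  map_one : (flagAt U₁ 1 (lastK r k₁) 1).map b = flagAt U₂ 1 (lastK r k₂) 1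

end TwoPointSpaces

/-! Each space has a frame `w 0, …, w r`, unique up to a common factor, in which all the flag terms
of the theorem are given by coordinate conditions that depend on neither `l` nor `k`. Sending frame
to frame is then a canonical map, and the conditions are rigid enough to allow only its multiples.

Let `d i` be the exponents at 0 and `e i` those at infinity. Elements `f` are studied through the
series `f / (1 - x)^κ`, with `κ = 0` for U and `κ = k + 1` for V. The vector `w j` is the one whose
series lives in the block `[d j, d (j + 1))`, the last block being infinite, so the flag at 0 is the
standard coordinate flag.

For U, consistency says `d i ≤ e i < d (i + 1)`, and `w j` is a polynomial supported in `[d j, e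
j]`. The flag at infinity is the opposite coordinate flag, and the line `F_1(1)` is spanned by `∑ w
j` after rescaling. This rests on a count of terms: only `r + k + 1` monomials are available, and a
nonzero polynomial with `N` terms cannot vanish at 1 to order `N` (`eq_zero_of_support_subset`).

For V, put `lam i = l_i - l_{i+1}`. The element `p` of least degree `e 0` is normalized to be `∑ w
j`. The coefficients of `p / (1 - x)^(k + 1)` are values of a polynomial of degree at most `k`, and
this polynomial vanishes at the `k` gap points `d i - 1, …, d i - lam i`. It is therefore a multiple
of `gapPoly` (`IsGapped.divCoeff_eq_gapPoly`), which determines `p` and hence its blocks. The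
hyperplane `F_r(1)` is `c_r = 0`, and `F_i(∞)` is `c_{i-1} = ⋯ = c_r`.

Existence runs the same description backwards. The explicit series satisfy a two-term recursion,
that is, a hypergeometric equation `P(θ) y = x Q(θ) y` with `θ = x d/dx`. Its singular points in the
plane are 0 and 1, and its indicial equation at 1 gives the required exponents
(`isTwoPointSpace_span`). -/

namespace TwoPointSpaces

/-! ### Exponents -/

section Orders

variable {ι M : Type*} [LinearOrder ι] [AddCommGroup M] [Module ℂ M]

/-- Triangularity: the functional at the least order occurring in a relation sees only one term. The
index set is any linear order, so that `ℕ` serves for orders of vanishing and `ℕᵒᵈ` for degrees. -/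
theorem linearIndependent_of_order_injective {α : Type*} (φ : ι → M →ₗ[ℂ] ℂ) (ν : α → ι)
    (x : α → M) (hν : Function.Injective ν) (h1 : ∀ a, φ (ν a) (x a) ≠ 0)
    (h2 : ∀ a, ∀ i < ν a, φ i (x a) = 0) : LinearIndependent ℂ x := by
  classical
  rw [linearIndependent_iff']
  intro s g hg
  by_contra! hcon
  obtain ⟨a₀, ha₀s, ha₀⟩ := hcon
  obtain ⟨a, ha, hmin⟩ := (s.filter fun a => g a ≠ 0).exists_min_image ν
    ⟨a₀, by simp [ha₀s, ha₀]⟩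
  rw [Finset.mem_filter] at ha
  have h := congrArg (φ (ν a)) hg
  rw [map_sum, map_zero, Finset.sum_eq_single_of_mem a ha.1] at h
  · rw [map_smul, smul_eq_mul, mul_eq_zero] at h
    exact h.elim ha.2 (h1 a)
  · intro b hb hba
    by_cases hgb : g b = 0
    · simp [hgb]
    · have hle := hmin b (by simp [hb, hgb])
      rw [map_smul, h2 b (ν a) (lt_of_le_of_ne hle fun h => hba (hν h.symm)), smul_zero]

/-- Vectors of distinct orders are independent, which bounds the number of orders above. Conversely
the functionals at the occurring orders are jointly injective, since each nonzero vector is detected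
at its own order. -/
theorem orders_finite_ncard (V : Submodule ℂ M) [Module.Finite ℂ V] (φ : ι → M →ₗ[ℂ] ℂ)
    (ν : M → ι) (h1 : ∀ x ∈ V, x ≠ 0 → φ (ν x) x ≠ 0)
    (h2 : ∀ x ∈ V, x ≠ 0 → ∀ i < ν x, φ i x = 0) :
    {d | ∃ x ∈ V, x ≠ 0 ∧ ν x = d}.Finite ∧
      {d | ∃ x ∈ V, x ≠ 0 ∧ ν x = d}.ncard = Module.finrank ℂ V := by
  set S := {d | ∃ x ∈ V, x ≠ 0 ∧ ν x = d} with hS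
  have hub : ∀ T : Finset ι, (T : Set ι) ⊆ S → T.card ≤ Module.finrank ℂ V := by
    intro T hT
    choose x hxV hx0 hxν using fun d : T => hT d.2
    have hli : LinearIndependent ℂ (fun d : T => (⟨x d, hxV d⟩ : V)) := by
      refine linearIndependent_of_order_injective (fun i => (φ i).comp V.subtype)
        (fun d : T => (d : ι)) _ Subtype.val_injective ?_ ?_
      · intro d
        have := h1 _ (hxV d) (hx0 d)
        rw [hxν] at this
        exact this
      · intro d i hi
        rw [← hxν d] at hi
        exact h2 _ (hxV d) (hx0 d) i hi
    simpa using hli.fintype_card_le_finrank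
  have hfin : S.Finite := by
    by_contra hinf
    obtain ⟨T, hT, hcard⟩ := Set.Infinite.exists_subset_card_eq hinf (Module.finrank ℂ V + 1)
    have := hub T hT
    omega
  refine ⟨hfin, le_antisymm ?_ ?_⟩
  · rw [Set.ncard_eq_toFinset_card S hfin]
    exact hub _ (by simp)
  · have hinj : Function.Injective
        (LinearMap.pi fun i : hfin.toFinset => (φ i).comp V.subtype) := by
      rw [← LinearMap.ker_eq_bot, LinearMap.ker_eq_bot']
      intro x hx
      by_contra hx0
      have hx0' : (x : M) ≠ 0 := fun h => hx0 (Subtype.ext h)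
      have hmem : ν (x : M) ∈ hfin.toFinset := by
        rw [Set.Finite.mem_toFinset]
        exact ⟨x, x.2, hx0', rfl⟩
      exact h1 _ x.2 hx0' (congrFun hx ⟨_, hmem⟩)
    have := LinearMap.finrank_le_finrank_of_injective hinj
    rw [Set.ncard_eq_toFinset_card S hfin]
    simpa using this

end Orders

theorem taylor_coeff_rootMultiplicity_ne_zero {f : ℂ[X]} (hf : f ≠ 0) (z : ℂ) :
    (taylor z f).coeff (f.rootMultiplicity z) ≠ 0 := by
  have h : taylor z f ≠ 0 := by
    rw [Ne, ← map_zero (taylor z)]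
    exact fun h => hf (taylor_injective z h)
  rw [rootMultiplicity_eq_natTrailingDegree, ← taylor_apply]
  exact trailingCoeff_nonzero_iff_nonzero.2 h

theorem taylor_coeff_eq_zero_of_lt_rootMultiplicity {f : ℂ[X]} {z : ℂ} {n : ℕ}
    (hn : n < f.rootMultiplicity z) : (taylor z f).coeff n = 0 := by
  rw [rootMultiplicity_eq_natTrailingDegree, ← taylor_apply] at hn
  exact coeff_eq_zero_of_lt_natTrailingDegree hn

theorem exponentsAt_finite_ncard (V : Submodule ℂ ℂ[X]) [Module.Finite ℂ V] (z : ℂ) :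
    (exponentsAt V z).Finite ∧ (exponentsAt V z).ncard = Module.finrank ℂ V :=
  orders_finite_ncard V (fun n => (lcoeff ℂ n).comp (taylor z))
    (fun f => f.rootMultiplicity z)
    (fun _ _ hf => taylor_coeff_rootMultiplicity_ne_zero hf z)
    (fun _ _ _ _ hn => taylor_coeff_eq_zero_of_lt_rootMultiplicity hn)

theorem exponentsAtInfty_finite_ncard (V : Submodule ℂ ℂ[X]) [Module.Finite ℂ V] :
    (exponentsAtInfty V).Finite ∧ (exponentsAtInfty V).ncard = Module.finrank ℂ V := by
  have h := orders_finite_ncard (ι := ℕᵒᵈ) V (fun n => lcoeff ℂ (OrderDual.ofDual n))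
    (fun f => OrderDual.toDual f.natDegree)
    (fun f _ hf => by simpa using hf)
    (fun f _ _ i hi => coeff_eq_zero_of_natDegree_lt hi)
  exact h

/-- Since the number of exponents is known, one inclusion is enough; the indicial equation only
supplies an inclusion. -/
theorem eq_image_of_subset_image {r : ℕ} {S : Set ℕ} (e : ℕ → ℕ) (hcard : S.ncard = r + 1)
    (h : S ⊆ e '' Set.Iic r) : S = e '' Set.Iic r := by
  refine Set.eq_of_subset_of_ncard_le h ?_ ((Set.finite_Iic r).image e)
  rw [hcard]
  refine (Set.ncard_image_le (Set.finite_Iic r)).trans ?_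
  rw [Set.ncard_eq_toFinset_card']
  simp

theorem eq_image_of_image_subset {r : ℕ} {S : Set ℕ} (e : ℕ → ℕ) (hfin : S.Finite)
    (hcard : S.ncard = r + 1) (he : Set.InjOn e (Set.Iic r)) (h : e '' Set.Iic r ⊆ S) :
    S = e '' Set.Iic r := by
  refine (Set.eq_of_subset_of_ncard_le h ?_ hfin).symm
  rw [hcard, he.ncard_image, Set.ncard_eq_toFinset_card']
  simp

/-- The dimension count that produces the frame vectors, and also the polynomial `p` in
`IsGapped.exists_seed`. -/
theorem exists_ne_zero_of_functionals {M ι : Type*} [AddCommGroup M] [Module ℂ M] [Fintype ι]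
    (V : Submodule ℂ M) [Module.Finite ℂ V] (hV : Fintype.card ι < Module.finrank ℂ V)
    (φ : ι → M →ₗ[ℂ] ℂ) : ∃ x ∈ V, x ≠ 0 ∧ ∀ t, φ t x = 0 := by
  have h := LinearMap.ker_ne_bot_of_finrank_lt
    (f := LinearMap.pi fun t => (φ t).comp V.subtype) (by simpa using hV)
  obtain ⟨x, hx, hx0⟩ := Submodule.exists_mem_ne_zero_of_ne_bot h
  exact ⟨x, x.2, fun h => hx0 (Subtype.ext h), fun t => congrFun hx t⟩

/-! ### Singular points -/

/-- A kernel vector of the Wronskian matrix at `z` is a combination whose derivatives of orders `0,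
…, r` all vanish at `z`. -/
theorem exists_of_isSingularPoint {r : ℕ} {V : Submodule ℂ ℂ[X]}
    (hV : Module.finrank ℂ V = r + 1) {z : ℂ} (hz : IsSingularPoint V z) :
    ∃ f ∈ V, f ≠ 0 ∧ r < f.rootMultiplicity z := by
  obtain ⟨N, b, hb⟩ := hz
  have hN : N = r + 1 := by rw [← hV, Module.finrank_eq_card_basis b, Fintype.card_fin]
  subst hN
  rw [IsRoot, wronskianDet, ← coe_evalRingHom, RingHom.map_det] at hb
  obtain ⟨c, hc0, hc⟩ := Matrix.exists_mulVec_eq_zero_iff.2 hb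
  have hmem : ∑ j, c j • b j ≠ 0 := by
    intro h
    exact hc0 (funext (Fintype.linearIndependent_iff.1 b.linearIndependent c h))
  have hne : ((∑ j, c j • b j : V) : ℂ[X]) ≠ 0 := fun h => hmem (Subtype.ext h)
  refine ⟨_, (∑ j, c j • b j : V).2, hne, ?_⟩
  rw [lt_rootMultiplicity_iff_isRoot_iterate_derivative hne]
  intro n hn
  have h := congrFun hc ⟨n, by omega⟩
  simp only [Matrix.mulVec, dotProduct, RingHom.mapMatrix_apply, Matrix.map_apply,
    Matrix.of_apply, Pi.zero_apply, coe_evalRingHom] at h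
  rw [IsRoot, ← h]
  simp only [Submodule.coe_sum, Submodule.coe_smul, iterate_derivative_sum,
    iterate_derivative_smul, eval_finsetSum, eval_smul, smul_eq_mul, mul_comm]

/-! ### The coefficients of `f / (1 - x)^κ` -/

/-- The `n`-th coefficient of the power series `f / (1 - x)^κ`. -/
noncomputable def divCoeff (κ n : ℕ) : ℂ[X] →ₗ[ℂ] ℂ where
  toFun f := PowerSeries.coeff n
    ((f : PowerSeries ℂ) * ((PowerSeries.invOneSubPow ℂ κ : (PowerSeries ℂ)ˣ) : PowerSeries ℂ))
  map_add' f g := by simp [add_mul]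
  map_smul' c f := by simp [Polynomial.coe_smul]

theorem mk_divCoeff_mul (κ : ℕ) (f : ℂ[X]) :
    PowerSeries.mk (fun n => divCoeff κ n f) * (1 - PowerSeries.X) ^ κ = (f : PowerSeries ℂ) := by
  have h : PowerSeries.mk (fun n => divCoeff κ n f) = (f : PowerSeries ℂ) *
      ((PowerSeries.invOneSubPow ℂ κ : (PowerSeries ℂ)ˣ) : PowerSeries ℂ) := by
    ext n; simp [divCoeff]
  rw [h, mul_assoc, ← PowerSeries.invOneSubPow_inv_eq_one_sub_pow, Units.inv_eq_val_inv,
    Units.mul_inv, mul_one]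

theorem divCoeff_eq_of_mul {κ : ℕ} {f : ℂ[X]} {G : PowerSeries ℂ}
    (h : G * (1 - PowerSeries.X) ^ κ = (f : PowerSeries ℂ)) (n : ℕ) :
    divCoeff κ n f = PowerSeries.coeff n G := by
  have : PowerSeries.coeff n
    ((f : PowerSeries ℂ) * ((PowerSeries.invOneSubPow ℂ κ : (PowerSeries ℂ)ˣ) : PowerSeries ℂ)) =
      PowerSeries.coeff n G := by
    rw [← h, mul_assoc, ← PowerSeries.invOneSubPow_inv_eq_one_sub_pow,
      Units.inv_eq_val_inv, Units.inv_mul, mul_one]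
  exact this

theorem eq_of_divCoeff_eq {κ : ℕ} {f g : ℂ[X]} (h : ∀ n, divCoeff κ n f = divCoeff κ n g) :
    f = g := by
  have hf := mk_divCoeff_mul κ f
  simp_rw [h] at hf
  rw [mk_divCoeff_mul κ g] at hf
  exact (Polynomial.coe_injective ℂ hf).symm

theorem X_pow_dvd_iff_divCoeff {κ N : ℕ} {f : ℂ[X]} :
    X ^ N ∣ f ↔ ∀ n < N, divCoeff κ n f = 0 := by
  have h1 : (X ^ N ∣ f) ↔ (PowerSeries.X ^ N ∣ (f : PowerSeries ℂ)) := by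
    rw [Polynomial.X_pow_dvd_iff, PowerSeries.X_pow_dvd_iff]
    simp
  rw [h1, ← Units.dvd_mul_right (u := PowerSeries.invOneSubPow ℂ κ), PowerSeries.X_pow_dvd_iff]
  rfl

theorem divCoeff_pow_mul (κ n : ℕ) (g : ℂ[X]) :
    divCoeff κ n ((1 - X) ^ κ * g) = g.coeff n := by
  rw [divCoeff_eq_of_mul (G := (g : PowerSeries ℂ)), coeff_coe]
  push_cast
  rw [mul_comm]

theorem divCoeff_zero (n : ℕ) (f : ℂ[X]) : divCoeff 0 n f = f.coeff n := by
  simpa using divCoeff_pow_mul 0 n f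

theorem one_sub_X_pow_dvd_iff {κ : ℕ} {f : ℂ[X]} : (1 - X) ^ κ ∣ f ↔ (X - C 1) ^ κ ∣ f := by
  have h : (1 - X : ℂ[X]) = -(X - C 1) := by simp
  have : Associated ((1 - X : ℂ[X]) ^ κ) ((X - C 1) ^ κ) := by
    refine Associated.pow_pow ?_
    rw [h]
    exact (Associated.refl _).neg_left
  exact this.dvd_iff_dvd_left

theorem natDegree_one_sub_X_pow_mul {κ : ℕ} {g : ℂ[X]} (hg : g ≠ 0) :
    ((1 - X) ^ κ * g).natDegree = κ + g.natDegree := by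
  have h : (1 - X : ℂ[X]) = -(X - C 1) := by simp
  have h0 : (1 - X : ℂ[X]) ≠ 0 := by rw [h]; exact neg_ne_zero.2 (X_sub_C_ne_zero 1)
  rw [natDegree_mul (pow_ne_zero _ h0) hg, natDegree_pow, h, natDegree_neg, natDegree_X_sub_C,
    mul_one]

theorem divCoeff_eq_zero_of_natDegree_lt {κ n : ℕ} {f : ℂ[X]} (hdvd : (1 - X) ^ κ ∣ f)
    (hdeg : f.natDegree < n + κ) : divCoeff κ n f = 0 := by
  obtain ⟨g, rfl⟩ := hdvd
  rw [divCoeff_pow_mul]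
  by_cases hg : g = 0
  · simp [hg]
  · rw [natDegree_one_sub_X_pow_mul hg] at hdeg
    exact coeff_eq_zero_of_natDegree_lt (by omega)

/-! ### The exponent sequence -/

theorem expo_strictMono {r : ℕ} (n : Fin r → ℕ) : StrictMono (expo n) := by
  refine strictMono_nat_of_lt_succ fun j => ?_
  unfold expo
  have : ∑ s : Fin r with s.val < j, n s ≤ ∑ s : Fin r with s.val < j + 1, n s := by
    refine Finset.sum_le_sum_of_subset fun s hs => ?_
    simp only [Finset.mem_filter, Finset.mem_univ, true_and] at hs ⊢
    omega
  omega

theorem expo_zero {r : ℕ} (n : Fin r → ℕ) : expo n 0 = 0 := by simp [expo]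

theorem expo_succ {r : ℕ} (n : Fin r → ℕ) (j : Fin r) :
    expo n (j + 1) = expo n j + 1 + n j := by
  unfold expo
  have : (Finset.univ.filter fun s : Fin r => s.val < (j : ℕ) + 1) =
      insert j (Finset.univ.filter fun s : Fin r => s.val < (j : ℕ)) := by
    ext s
    simp only [Finset.mem_filter, Finset.mem_univ, true_and, Finset.mem_insert, Fin.ext_iff]
    omega
  rw [this, Finset.sum_insert (by simp)]
  omega

/-! ### The hypergeometric equation -/

/-- The numerators of `(x d/dx)^n (v / (1 - x)^κ)` over the denominators `(1 - x)^(κ + n)`. -/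
noncomputable def eulerNumerator (κ : ℕ) (v : ℂ[X]) : ℕ → ℂ[X]
  | 0 => v
  | n + 1 => C ((κ + n : ℕ) : ℂ) * X * eulerNumerator κ v n +
      (1 - X) * X * derivative (eulerNumerator κ v n)

/-- The operator `θ = x d/dx` multiplies the `m`-th coefficient by `m`, and the quotient rule for
`θ` is the recursion of `eulerNumerator`. -/
theorem mk_pow_mul_eq_eulerNumerator {κ : ℕ} {v : ℂ[X]} {c : ℕ → ℂ}
    (hc : PowerSeries.mk c * (1 - PowerSeries.X) ^ κ = (v : PowerSeries ℂ)) (n : ℕ) :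
    PowerSeries.mk (fun m => (m : ℂ) ^ n * c m) * (1 - PowerSeries.X) ^ (κ + n) =
      (eulerNumerator κ v n : PowerSeries ℂ) := by
  induction n with
  | zero => simpa [eulerNumerator] using hc
  | succ n ih =>
    have h1 : PowerSeries.mk (fun m => (m : ℂ) ^ (n + 1) * c m) =
        PowerSeries.X * PowerSeries.derivative ℂ (PowerSeries.mk fun m => (m : ℂ) ^ n * c m) := by
      ext m
      cases m with
      | zero => simp
      | succ m =>
        rw [PowerSeries.coeff_succ_X_mul, PowerSeries.coeff_derivative]
        simp only [PowerSeries.coeff_mk]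
        push_cast
        ring
    have h2 := congrArg (PowerSeries.derivative ℂ) ih
    rw [PowerSeries.derivative_coe, Derivation.leibniz, PowerSeries.derivative_pow] at h2
    have h3 : PowerSeries.derivative ℂ (1 - PowerSeries.X : PowerSeries ℂ) = -1 := by
      simp
    -- The exponent `κ + n - 1` is truncated at `κ + n = 0`, where the factor `κ + n` makes this
    -- harmless.
    have h4 : ((κ + n : ℕ) : PowerSeries ℂ) * (1 - PowerSeries.X) ^ (κ + n - 1) *
        (1 - PowerSeries.X) = ((κ + n : ℕ) : PowerSeries ℂ) * (1 - PowerSeries.X) ^ (κ + n) := by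
      rcases Nat.eq_zero_or_pos (κ + n) with h0 | h0
      · simp [h0]
      · rw [mul_assoc, ← pow_succ, Nat.sub_add_cancel h0]
    rw [h3] at h2
    simp only [smul_eq_mul] at h2
    rw [eulerNumerator, h1]
    have hC : ((C ((κ + n : ℕ) : ℂ) : ℂ[X]) : PowerSeries ℂ) = ((κ + n : ℕ) : PowerSeries ℂ) := by
      rw [Polynomial.coe_C, map_natCast]
    rw [Polynomial.coe_add, Polynomial.coe_mul, Polynomial.coe_mul, Polynomial.coe_mul,
      Polynomial.coe_mul, Polynomial.coe_sub, Polynomial.coe_X, Polynomial.coe_one, hC, ← h2, ← ih,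
      ← add_assoc κ n 1, pow_succ]
    linear_combination (PowerSeries.X : PowerSeries ℂ) *
      (PowerSeries.mk fun m => (m : ℂ) ^ n * c m) * h4

theorem mk_eval_mul_eq_sum {N : ℕ} {P : ℂ[X]} (hP : P.natDegree ≤ N) (c : ℕ → ℂ) :
    PowerSeries.mk (fun m => P.eval (m : ℂ) * c m) =
      ∑ i ∈ Finset.range (N + 1),
        PowerSeries.C (P.coeff i) * PowerSeries.mk (fun m => (m : ℂ) ^ i * c m) := by
  ext m
  rw [map_sum, PowerSeries.coeff_mk, eval_eq_sum_range' (Nat.lt_succ_of_le hP), Finset.sum_mul]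
  refine Finset.sum_congr rfl fun i _ => ?_
  rw [PowerSeries.coeff_C_mul, PowerSeries.coeff_mk, mul_assoc]

/-- The recursion says `P(θ) y = x Q(θ) y` for `y = v / (1 - x)^κ`, the constant terms agreeing by
`P(0) = 0`. Multiplication by `(1 - x)^(κ + N)` clears the denominators. -/
theorem sum_eulerNumerator_eq_zero {κ N : ℕ} {v P Q : ℂ[X]} {c : ℕ → ℂ}
    (hc : PowerSeries.mk c * (1 - PowerSeries.X) ^ κ = (v : PowerSeries ℂ))
    (hP : P.natDegree ≤ N) (hQ : Q.natDegree ≤ N) (h0 : P.eval 0 = 0)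
    (hrec : ∀ n : ℕ, P.eval ((n : ℂ) + 1) * c (n + 1) = Q.eval (n : ℂ) * c n) :
    ∑ i ∈ Finset.range (N + 1), (C (P.coeff i) - X * C (Q.coeff i)) * (1 - X) ^ (N - i) *
      eulerNumerator κ v i = 0 := by
  have hser : PowerSeries.mk (fun m => P.eval (m : ℂ) * c m) =
      PowerSeries.X * PowerSeries.mk (fun m => Q.eval (m : ℂ) * c m) := by
    ext m
    cases m with
    | zero => simp [h0]
    | succ m =>
      rw [PowerSeries.coeff_succ_X_mul, PowerSeries.coeff_mk, PowerSeries.coeff_mk]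
      exact_mod_cast hrec m
  rw [mk_eval_mul_eq_sum hP, mk_eval_mul_eq_sum hQ, Finset.mul_sum, ← sub_eq_zero,
    ← Finset.sum_sub_distrib] at hser
  apply Polynomial.coe_injective ℂ
  rw [Polynomial.coe_zero]
  have := congrArg (fun G => G * (1 - PowerSeries.X : PowerSeries ℂ) ^ (κ + N)) hser
  simp only [zero_mul, Finset.sum_mul] at this
  rw [← this, ← Polynomial.coeToPowerSeries.ringHom_apply, map_sum]
  refine Finset.sum_congr rfl fun i hi => ?_
  rw [Polynomial.coeToPowerSeries.ringHom_apply]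
  rw [Polynomial.coe_mul, ← mk_pow_mul_eq_eulerNumerator hc i]
  have hiN : κ + N = (κ + i) + (N - i) := by
    have := Finset.mem_range.1 hi
    omega
  rw [hiN, pow_add]
  push_cast
  ring

theorem X_sub_C_mul_derivative_pow (z : ℂ) (n : ℕ) :
    (X - C z) * derivative ((X - C z) ^ n) = C (n : ℂ) * (X - C z) ^ n := by
  rw [derivative_X_sub_C_pow]
  cases n with
  | zero => simp
  | succ n => rw [Nat.add_sub_cancel, pow_succ]; ring

theorem X_sub_C_mul_derivative_pow_mul (z : ℂ) (n : ℕ) (h : ℂ[X]) :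
    (X - C z) * derivative ((X - C z) ^ n * h) =
      (X - C z) ^ n * (C (n : ℂ) * h + (X - C z) * derivative h) := by
  rw [derivative_mul]
  linear_combination h * X_sub_C_mul_derivative_pow z n

/-- Each step lowers the order at `z` by one and multiplies the leading coefficient by `z (1 - z) (s
- n)`. The factor `(X - C z) ^ n` on the left avoids negative powers when `n > s`. -/
theorem exists_eulerNumerator_local (κ s : ℕ) (z : ℂ) (h : ℂ[X]) :
    ∃ H : ℕ → ℂ[X], ∀ n,
      (X - C z) ^ n * eulerNumerator κ ((X - C z) ^ s * h) n = (X - C z) ^ s * H n ∧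
      (H n).eval z = (z * (1 - z)) ^ n * (∏ i ∈ Finset.range n, ((s : ℂ) - i)) * h.eval z := by
  set v := (X - C z) ^ s * h with hv
  let H : ℕ → ℂ[X] := fun n => Nat.rec h (fun n Hn => C ((κ + n : ℕ) : ℂ) * X * (X - C z) * Hn +
    (1 - X) * X * (C ((s : ℂ) - n) * Hn + (X - C z) * derivative Hn)) n
  refine ⟨H, fun n => ?_⟩
  have hH : ∀ n, H (n + 1) = C ((κ + n : ℕ) : ℂ) * X * (X - C z) * H n +
    (1 - X) * X * (C ((s : ℂ) - n) * H n + (X - C z) * derivative (H n)) := fun n => rfl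
  induction n with
  | zero => exact ⟨by simp [eulerNumerator, hv, H], by simp [H]⟩
  | succ n ih =>
    refine ⟨?_, ?_⟩
    · have hd := congrArg (fun p => (X - C z) * derivative p) ih.1
      simp only [X_sub_C_mul_derivative_pow_mul] at hd
      rw [hH, eulerNumerator, map_sub]
      linear_combination (C ((κ + n : ℕ) : ℂ) * X * (X - C z)) * ih.1 +
        (1 - X) * X * hd - (1 - X) * X * C (n : ℂ) * ih.1
    · rw [hH, Finset.prod_range_succ]
      simp only [eval_add, eval_mul, eval_sub, eval_X, eval_C, eval_one, ih.2]
      ring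

/-- At 1 the factor `1 - x` from the denominator makes up for the order lost by differentiation, so
`(X - C 1) ^ s` stays and the leading coefficient acquires the factor `κ + n - s`. -/
theorem exists_eulerNumerator_at_one (κ s : ℕ) (h : ℂ[X]) :
    ∃ H : ℕ → ℂ[X], ∀ n,
      eulerNumerator κ ((X - C 1) ^ s * h) n = (X - C 1) ^ s * H n ∧
      (H n).eval 1 = (∏ i ∈ Finset.range n, ((κ : ℂ) + i - s)) * h.eval 1 := by
  set v := (X - C 1) ^ s * h with hv
  let H : ℕ → ℂ[X] := fun n => Nat.rec h (fun n Hn => C ((κ + n : ℕ) : ℂ) * X * Hn -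
    X * (C (s : ℂ) * Hn + (X - C 1) * derivative Hn)) n
  refine ⟨H, fun n => ?_⟩
  have hH : ∀ n, H (n + 1) = C ((κ + n : ℕ) : ℂ) * X * H n -
    X * (C (s : ℂ) * H n + (X - C 1) * derivative (H n)) := fun n => rfl
  induction n with
  | zero => exact ⟨by simp [eulerNumerator, hv, H], by simp [H]⟩
  | succ n ih =>
    refine ⟨?_, ?_⟩
    · have hd := X_sub_C_mul_derivative_pow_mul 1 s (H n)
      rw [hH, eulerNumerator, ih.1]
      rw [map_one] at hd ⊢
      linear_combination (-X) * hd
    · rw [hH, Finset.prod_range_succ]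
      simp only [eval_add, eval_mul, eval_sub, eval_X, eval_C, ih.2]
      push_cast
      ring

/-- The coefficient of `θ^(r+1)` is `1 - x`, so such `z` is an ordinary point: its indicial
polynomial is `s (s - 1) ⋯ (s - r)` up to a nonzero factor. -/
theorem rootMultiplicity_le_of_ode {κ r : ℕ} {v P Q : ℂ[X]} (hv : v ≠ 0)
    (hP : P.coeff (r + 1) = 1) (hQ : Q.coeff (r + 1) = 1)
    (hode : ∑ i ∈ Finset.range (r + 2), (C (P.coeff i) - X * C (Q.coeff i)) *
      (1 - X) ^ (r + 1 - i) * eulerNumerator κ v i = 0)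
    {z : ℂ} (hz0 : z ≠ 0) (hz1 : z ≠ 1) : v.rootMultiplicity z ≤ r := by
  by_contra! hs
  obtain ⟨h, hvh, hnd⟩ := exists_eq_pow_rootMultiplicity_mul_and_not_dvd v hv z
  set s := v.rootMultiplicity z
  have hhz : h.eval z ≠ 0 := fun h0 => hnd (dvd_iff_isRoot.2 h0)
  obtain ⟨H, hH⟩ := exists_eulerNumerator_local κ s z h
  rw [← hvh] at hH
  have h1 : (X - C z) ^ s * ∑ i ∈ Finset.range (r + 2), (C (P.coeff i) - X * C (Q.coeff i)) *
      ((1 - X) * (X - C z)) ^ (r + 1 - i) * H i = 0 := by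
    rw [← mul_zero ((X - C z) ^ (r + 1)), ← hode, Finset.mul_sum, Finset.mul_sum]
    refine Finset.sum_congr rfl fun i hi => ?_
    have hi' : r + 1 = (r + 1 - i) + i := by
      have := Finset.mem_range.1 hi
      omega
    have e1 : (X - C z) ^ (r + 1) = (X - C z) ^ (r + 1 - i) * (X - C z) ^ i := by
      rw [← pow_add, ← hi']
    rw [e1, mul_pow]
    linear_combination (-(C (P.coeff i) - X * C (Q.coeff i)) *
      ((1 - X) ^ (r + 1 - i) * (X - C z) ^ (r + 1 - i))) * (hH i).1
  have h2 := (mul_eq_zero.1 h1).resolve_left (pow_ne_zero _ (X_sub_C_ne_zero z))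
  have h3 := congrArg (eval z) h2
  rw [eval_finsetSum, Finset.sum_range_succ, Finset.sum_eq_zero, hP, hQ] at h3
  · simp only [eval_mul, eval_sub, eval_X, eval_C, eval_zero, Nat.sub_self, pow_zero,
      (hH (r + 1)).2, zero_add, mul_one, mul_eq_zero, hhz, or_false] at h3
    have hz1' : (1 : ℂ) - z ≠ 0 := sub_ne_zero.2 hz1.symm
    rcases h3 with h3 | h3 | h3
    · exact hz1' h3
    · exact pow_ne_zero _ (mul_ne_zero hz0 hz1') h3
    · obtain ⟨i, hi, h4⟩ := Finset.prod_eq_zero_iff.1 h3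
      rw [sub_eq_zero, Nat.cast_inj] at h4
      have := Finset.mem_range.1 hi
      omega
  · intro i hi
    have hi' := Finset.mem_range.1 hi
    simp only [eval_mul, eval_sub, eval_X, eval_C, eval_pow, sub_self, mul_zero]
    rw [zero_pow (by omega)]
    ring

/-- Every term contains a factor `1 - X`, the top one through its coefficient. Once this factor is
cancelled, only the terms `i = r` and `i = r + 1` survive at 1. -/
theorem indicial_eq_zero_of_ode {κ r : ℕ} {v P Q : ℂ[X]} (hv : v ≠ 0)
    (hP : P.coeff (r + 1) = 1) (hQ : Q.coeff (r + 1) = 1)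
    (hode : ∑ i ∈ Finset.range (r + 2), (C (P.coeff i) - X * C (Q.coeff i)) *
      (1 - X) ^ (r + 1 - i) * eulerNumerator κ v i = 0) :
    (P.coeff r - Q.coeff r + κ + r - v.rootMultiplicity 1) *
      ∏ i ∈ Finset.range r, ((κ : ℂ) + i - v.rootMultiplicity 1) = 0 := by
  obtain ⟨h, hvh, hnd⟩ := exists_eq_pow_rootMultiplicity_mul_and_not_dvd v hv 1
  set s := v.rootMultiplicity 1
  have hhz : h.eval 1 ≠ 0 := fun h0 => hnd (dvd_iff_isRoot.2 h0)
  obtain ⟨H, hH⟩ := exists_eulerNumerator_at_one κ s h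
  rw [← hvh] at hH
  have h1X : (1 - X : ℂ[X]) ≠ 0 := by
    rw [← neg_ne_zero, neg_sub]
    exact X_sub_C_ne_zero 1
  have h1 : ((X - C 1) ^ s * (1 - X)) * (∑ i ∈ Finset.range r, (C (P.coeff i) - X * C (Q.coeff i)) *
      (1 - X) ^ (r - i) * H i + ((C (P.coeff r) - X * C (Q.coeff r)) * H r + H (r + 1))) = 0 := by
    have hsum : ((X - C 1) ^ s * (1 - X)) * ∑ i ∈ Finset.range r,
        (C (P.coeff i) - X * C (Q.coeff i)) * (1 - X) ^ (r - i) * H i =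
        ∑ i ∈ Finset.range r, (C (P.coeff i) - X * C (Q.coeff i)) *
          (1 - X) ^ (r + 1 - i) * eulerNumerator κ v i := by
      rw [Finset.mul_sum]
      refine Finset.sum_congr rfl fun i hi => ?_
      have hi' : r + 1 - i = (r - i) + 1 := by
        have := Finset.mem_range.1 hi
        omega
      rw [hi', (hH i).1, pow_succ]
      ring
    rw [Finset.sum_range_succ, Finset.sum_range_succ, (hH r).1, (hH (r + 1)).1, hP, hQ,
      show r + 1 - r = 1 by omega, show r + 1 - (r + 1) = 0 by omega, pow_one, pow_zero,
      mul_one] at hode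
    have hC1 : (C 1 : ℂ[X]) = 1 := map_one C
    rw [mul_add, hsum]
    generalize ∑ i ∈ Finset.range r, (C (P.coeff i) - X * C (Q.coeff i)) *
      (1 - X) ^ (r + 1 - i) * eulerNumerator κ v i = A at hode ⊢
    rw [← hode]
    generalize H r = A₁
    generalize H (r + 1) = A₂
    rw [hC1]
    ring
  have h2 := (mul_eq_zero.1 h1).resolve_left
    (mul_ne_zero (pow_ne_zero _ (X_sub_C_ne_zero 1)) h1X)
  have h3 := congrArg (eval 1) h2
  rw [eval_add, eval_finsetSum, Finset.sum_eq_zero] at h3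
  · simp only [eval_add, eval_mul, eval_sub, eval_X, eval_C, eval_zero, (hH _).2, zero_add,
      Finset.prod_range_succ] at h3
    refine (mul_eq_zero.1 (?_ : _ * h.eval 1 = 0)).resolve_right hhz
    linear_combination h3
  · intro i hi
    have hi' := Finset.mem_range.1 hi
    simp only [eval_mul, eval_sub, eval_X, eval_C, eval_pow, eval_one, sub_self]
    rw [zero_pow (by omega)]
    ring

/-! ### Families supported in consecutive blocks -/

/-- `n` lies in the `j`-th of the blocks `[d 0, d 1)`, …, `[d (r - 1), d r)`, `[d r, ∞)`. -/
def InBlock (r : ℕ) (d : ℕ → ℕ) (j n : ℕ) : Prop := d j ≤ n ∧ (j < r → n < d (j + 1))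

theorem InBlock.eq {r : ℕ} {d : ℕ → ℕ} (hd : StrictMono d) {i j n : ℕ} (hi : i ≤ r) (hj : j ≤ r)
    (h1 : InBlock r d i n) (h2 : InBlock r d j n) : i = j := by
  rcases lt_trichotomy i j with h | h | h
  · have := h1.2 (by omega)
    have := hd.monotone (show i + 1 ≤ j by omega)
    have := h2.1
    omega
  · exact h
  · have := h2.2 (by omega)
    have := hd.monotone (show j + 1 ≤ i by omega)
    have := h1.1
    omega

theorem inBlock_self (r : ℕ) {d : ℕ → ℕ} (hd : StrictMono d) (j : ℕ) : InBlock r d j (d j) :=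
  ⟨le_rfl, fun _ => hd (Nat.lt_succ_self j)⟩

/-- The expansions of `w j / (1 - x)^κ` are supported in consecutive blocks and start at the left
ends of the blocks. -/
structure IsBlockFamily {r : ℕ} (κ : ℕ) (d : ℕ → ℕ) (w : Fin (r + 1) → ℂ[X]) : Prop where
  support : ∀ (j : Fin (r + 1)) (n : ℕ), divCoeff κ n (w j) ≠ 0 → InBlock r d j n
  ne_zero : ∀ j : Fin (r + 1), divCoeff κ (d j) (w j) ≠ 0

namespace IsBlockFamily

variable {r κ : ℕ} {d : ℕ → ℕ} {w w' : Fin (r + 1) → ℂ[X]}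

theorem divCoeff_eq_zero (h : IsBlockFamily κ d w) (hd : StrictMono d) {i j : Fin (r + 1)} {n : ℕ}
    (hn : InBlock r d j n) (hij : i ≠ j) : divCoeff κ n (w i) = 0 := by
  by_contra h0
  exact hij (Fin.ext ((h.support i n h0).eq hd (by omega) (by omega) hn))

theorem divCoeff_sum (h : IsBlockFamily κ d w) (hd : StrictMono d) (c : Fin (r + 1) → ℂ)
    {j : Fin (r + 1)} {n : ℕ} (hn : InBlock r d j n) :
    divCoeff κ n (∑ i, c i • w i) = c j * divCoeff κ n (w j) := by
  rw [map_sum, Finset.sum_eq_single j, map_smul, smul_eq_mul]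
  · intro i _ hij
    rw [map_smul, h.divCoeff_eq_zero hd hn hij, smul_zero]
  · simp

theorem linearIndependent (h : IsBlockFamily κ d w) (hd : StrictMono d) :
    LinearIndependent ℂ w := by
  rw [Fintype.linearIndependent_iff]
  intro c hc j
  have := h.divCoeff_sum hd c (inBlock_self r hd j)
  rw [hc, map_zero] at this
  exact (mul_eq_zero.1 this.symm).resolve_right (h.ne_zero j)

theorem X_pow_dvd_sum_iff (h : IsBlockFamily κ d w) (hd : StrictMono d) (c : Fin (r + 1) → ℂ)
    (N : ℕ) : X ^ d N ∣ ∑ i, c i • w i ↔ ∀ j : Fin (r + 1), (j : ℕ) < N → c j = 0 := by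
  rw [X_pow_dvd_iff_divCoeff (κ := κ)]
  constructor
  · intro H j hj
    have := h.divCoeff_sum hd c (inBlock_self r hd j)
    rw [H _ (hd hj)] at this
    exact (mul_eq_zero.1 this.symm).resolve_right (h.ne_zero j)
  · intro H n hn
    rw [map_sum]
    refine Finset.sum_eq_zero fun i _ => ?_
    rw [map_smul]
    by_cases hi : (i : ℕ) < N
    · rw [H i hi, zero_smul]
    · have h0 : divCoeff κ n (w i) = 0 := by
        by_contra h0
        have := (h.support i n h0).1
        have := hd.monotone (show N ≤ i by omega)
        omega
      rw [h0, smul_zero]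

/-- The blocks are disjoint, so each member is read off from the series of the sum. Uniqueness of a
frame thus reduces to uniqueness of one element. -/
theorem eq_of_sum_eq (h : IsBlockFamily κ d w) (h' : IsBlockFamily κ d w') (hd : StrictMono d)
    (hs : ∑ i, w i = ∑ i, w' i) : w = w' := by
  funext j
  refine eq_of_divCoeff_eq (κ := κ) fun n => ?_
  by_cases hn : InBlock r d j n
  · have h1 := h.divCoeff_sum hd (fun _ => 1) hn
    have h2 := h'.divCoeff_sum hd (fun _ => 1) hn
    simp only [one_smul, one_mul] at h1 h2
    rw [← h1, ← h2, hs]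
  · rw [not_imp_comm.1 (h.support j n) hn, not_imp_comm.1 (h'.support j n) hn]

theorem smul (h : IsBlockFamily κ d w) {c : Fin (r + 1) → ℂ} (hc : ∀ j, c j ≠ 0) :
    IsBlockFamily κ d (fun j => c j • w j) where
  support j n hn := h.support j n fun h0 => hn (by rw [map_smul, h0, smul_zero])
  ne_zero j := by
    rw [map_smul, smul_eq_mul]
    exact mul_ne_zero (hc j) (h.ne_zero j)

theorem rootMultiplicity_zero (h : IsBlockFamily κ d w) (j : Fin (r + 1)) :
    w j ≠ 0 ∧ (w j).rootMultiplicity 0 = d j := by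
  have h0 : w j ≠ 0 := by
    intro h0
    have := h.ne_zero j
    rw [h0, map_zero] at this
    exact this rfl
  refine ⟨h0, le_antisymm ?_ ?_⟩
  · by_contra! hlt
    have h1 := (le_rootMultiplicity_iff h0).1 (Nat.succ_le_of_lt hlt)
    rw [map_zero, sub_zero, X_pow_dvd_iff_divCoeff (κ := κ)] at h1
    exact h.ne_zero j (h1 _ (Nat.lt_succ_self _))
  · rw [le_rootMultiplicity_iff h0, map_zero, sub_zero, X_pow_dvd_iff_divCoeff (κ := κ)]
    intro n hn
    by_contra h1
    have := (h.support j n h1).1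
    omega

theorem span_eq (h : IsBlockFamily κ d w) (hd : StrictMono d) {V : Submodule ℂ ℂ[X]}
    [Module.Finite ℂ V] (hV : Module.finrank ℂ V = r + 1) (hmem : ∀ j, w j ∈ V) :
    Submodule.span ℂ (Set.range w) = V := by
  refine Submodule.eq_of_le_of_finrank_eq (Submodule.span_le.2 ?_) ?_
  · rintro _ ⟨j, rfl⟩
    exact hmem j
  · rw [finrank_span_eq_card (h.linearIndependent hd), hV, Fintype.card_fin]

theorem exists_basis (h : IsBlockFamily κ d w) (hd : StrictMono d) {V : Submodule ℂ ℂ[X]}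
    (hV : Module.finrank ℂ V = r + 1) (hmem : ∀ j, w j ∈ V) :
    ∃ b : Module.Basis (Fin (r + 1)) ℂ V, ∀ j, (b j : ℂ[X]) = w j := by
  have hli : LinearIndependent ℂ (fun j => (⟨w j, hmem j⟩ : V)) :=
    LinearIndependent.of_comp V.subtype (h.linearIndependent hd)
  refine ⟨basisOfLinearIndependentOfCardEqFinrank hli (by rw [hV, Fintype.card_fin]), fun j => ?_⟩
  rw [coe_basisOfLinearIndependentOfCardEqFinrank]

/-- The order of `w j` at 0 is some `d t` and its series is nonzero there; the only `d t` lying in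
the `j`-th block is `d j`. -/
theorem of_support (hd : StrictMono d) {V : Submodule ℂ ℂ[X]}
    (hV : exponentsAt V 0 = d '' Set.Iic r) (hmem : ∀ j, w j ∈ V) (hne : ∀ j, w j ≠ 0)
    (hsupp : ∀ (j : Fin (r + 1)) (n : ℕ), divCoeff κ n (w j) ≠ 0 → InBlock r d j n) :
    IsBlockFamily κ d w where
  support := hsupp
  ne_zero j := by
    have hρ : divCoeff κ ((w j).rootMultiplicity 0) (w j) ≠ 0 := by
      intro h0
      have h1 : ∀ n < (w j).rootMultiplicity 0, divCoeff κ n (w j) = 0 := by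
        rw [← X_pow_dvd_iff_divCoeff]
        simpa using pow_rootMultiplicity_dvd (w j) 0
      have h2 : X ^ ((w j).rootMultiplicity 0 + 1) ∣ w j := by
        rw [X_pow_dvd_iff_divCoeff (κ := κ)]
        intro n hn
        rcases Nat.lt_succ_iff_lt_or_eq.1 hn with h | h
        · exact h1 n h
        · rw [h, h0]
      have h3 := (le_rootMultiplicity_iff (a := 0) (n := (w j).rootMultiplicity 0 + 1) (hne j)).2
        (by simpa using h2)
      omega
    obtain ⟨t, ht, htρ⟩ : (w j).rootMultiplicity 0 ∈ d '' Set.Iic r :=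
      hV ▸ ⟨w j, hmem j, hne j, rfl⟩
    rw [← htρ] at hρ
    have := (hsupp j _ hρ).eq hd (by omega) ht (inBlock_self r hd t)
    rw [this]
    exact hρ

theorem exists_sum_eq (h : IsBlockFamily κ d w) (hd : StrictMono d) {V : Submodule ℂ ℂ[X]}
    [Module.Finite ℂ V] (hV : Module.finrank ℂ V = r + 1) (hmem : ∀ j, w j ∈ V) {p : ℂ[X]}
    (hp : p ∈ V) : ∃ c : Fin (r + 1) → ℂ, ∑ j, c j • w j = p := by
  rw [← h.span_eq hd hV hmem] at hp
  exact (Submodule.mem_span_range_iff_exists_fun ℂ).1 hp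

end IsBlockFamily

/-- Only the coefficients at exponents need testing, since the order of vanishing is itself an
exponent. Hence vanishing to order `d j` costs just `j` linear conditions. -/
theorem X_pow_dvd_of_coeff_eq_zero {r : ℕ} {d : ℕ → ℕ} (hd : StrictMono d) {V : Submodule ℂ ℂ[X]}
    (hV : exponentsAt V 0 = d '' Set.Iic r) {x : ℂ[X]} (hx : x ∈ V) (hx0 : x ≠ 0) {j : ℕ}
    (h : ∀ t < j, x.coeff (d t) = 0) : X ^ d j ∣ x := by
  obtain ⟨t, -, ht⟩ : x.rootMultiplicity 0 ∈ d '' Set.Iic r := hV ▸ ⟨x, hx, hx0, rfl⟩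
  have h1 := taylor_coeff_rootMultiplicity_ne_zero hx0 0
  rw [taylor_zero, ← ht] at h1
  have h2 : j ≤ t := by
    by_contra! hlt
    exact h1 (h t hlt)
  have h3 : d j ≤ x.rootMultiplicity 0 := ht ▸ hd.monotone h2
  simpa using (le_rootMultiplicity_iff hx0).1 h3

theorem natDegree_le_of_coeff_eq_zero {r : ℕ} {e : ℕ → ℕ} (he : MonotoneOn e (Set.Iic r))
    {V : Submodule ℂ ℂ[X]} (hV : exponentsAtInfty V = e '' Set.Iic r) {x : ℂ[X]} (hx : x ∈ V)
    (hx0 : x ≠ 0) {j : ℕ} (hj : j ≤ r) (h : ∀ t, j < t → t ≤ r → x.coeff (e t) = 0) :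
    x.natDegree ≤ e j := by
  obtain ⟨t, htr, ht⟩ : x.natDegree ∈ e '' Set.Iic r := hV ▸ ⟨x, hx, hx0, rfl⟩
  have h1 : x.coeff (e t) ≠ 0 := by
    rw [ht]
    exact leadingCoeff_ne_zero.2 hx0
  have h2 : t ≤ j := by
    by_contra! hlt
    exact h1 (h t hlt htr)
  rw [← ht]
  exact he htr hj h2

/-! ### Spaces of solutions of hypergeometric equations -/

theorem prod_X_sub_C_range (d : ℕ → ℂ) (r : ℕ) :
    (∏ i ∈ Finset.range (r + 1), (X - C (d i))).natDegree ≤ r + 1 ∧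
    (∏ i ∈ Finset.range (r + 1), (X - C (d i))).coeff (r + 1) = 1 ∧
    (∏ i ∈ Finset.range (r + 1), (X - C (d i))).coeff r = -∑ i ∈ Finset.range (r + 1), d i := by
  have h1 : (∏ i ∈ Finset.range (r + 1), (X - C (d i))).natDegree = r + 1 := by
    rw [natDegree_prod_of_monic _ _ fun i _ => monic_X_sub_C _]
    simp
  refine ⟨h1.le, ?_, ?_⟩
  · have := (monic_prod_of_monic (Finset.range (r + 1)) _ fun i _ => monic_X_sub_C (d i))
    rw [Monic, leadingCoeff, h1] at this
    exact this
  · have := prod_X_sub_C_coeff_card_pred (Finset.range (r + 1)) d (by simp)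
    simpa using this

/-- The recursion passes to the span and becomes the differential equation, which bounds the orders
at every `z ≠ 0, 1` by `r` and confines those at 1 to roots of the indicial equation. Counting
exponents turns these inclusions into equalities. At each point 0 is then an exponent, so there are
no base points. -/
theorem isTwoPointSpace_span {r κ : ℕ} {n₀ n₁ : Fin r → ℕ} {e : ℕ → ℕ} (ε : ℕ → ℂ)
    {w : Fin (r + 1) → ℂ[X]} (hw : IsBlockFamily κ (expo n₀) w)
    (hrec : ∀ (j : Fin (r + 1)) (n : ℕ), (∏ i ∈ Finset.range (r + 1), ((n : ℂ) + 1 - expo n₀ i)) *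
        divCoeff κ (n + 1) (w j) =
      (∏ i ∈ Finset.range (r + 1), ((n : ℂ) - ε i)) * divCoeff κ n (w j))
    (hone : ∀ s : ℕ, (∑ i ∈ Finset.range (r + 1), ε i - ∑ i ∈ Finset.range (r + 1), (expo n₀ i : ℂ)
      + κ + r - s) * ∏ i ∈ Finset.range r, ((κ : ℂ) + i - s) = 0 → s ∈ expo n₁ '' Set.Iic r)
    (he : Set.InjOn e (Set.Iic r))
    (hdeg : ∀ i ≤ r, ∃ x ∈ Submodule.span ℂ (Set.range w), x ≠ 0 ∧ x.natDegree = e i) :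
    IsTwoPointSpace r n₀ n₁ e (Submodule.span ℂ (Set.range w)) := by
  set V := Submodule.span ℂ (Set.range w) with hVdef
  have hd := expo_strictMono n₀
  have hfin : Module.Finite ℂ V := Module.Finite.span_of_finite ℂ (Set.finite_range w)
  have hrank : Module.finrank ℂ V = r + 1 := by
    rw [finrank_span_eq_card (hw.linearIndependent hd), Fintype.card_fin]
  set P : ℂ[X] := ∏ i ∈ Finset.range (r + 1), (X - C (expo n₀ i : ℂ)) with hP
  set Q : ℂ[X] := ∏ i ∈ Finset.range (r + 1), (X - C (ε i)) with hQ
  obtain ⟨hP1, hP2, hP3⟩ := prod_X_sub_C_range (fun i => (expo n₀ i : ℂ)) r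
  obtain ⟨hQ1, hQ2, hQ3⟩ := prod_X_sub_C_range ε r
  have hP0 : P.eval 0 = 0 := by
    rw [hP, eval_prod]
    exact Finset.prod_eq_zero (i := 0) (by simp) (by simp [expo_zero])
  have hrecV : ∀ v ∈ V, ∀ n : ℕ, P.eval ((n : ℂ) + 1) * divCoeff κ (n + 1) v =
      Q.eval (n : ℂ) * divCoeff κ n v := by
    intro v hv n
    rw [hP, hQ, eval_prod, eval_prod]
    simp only [eval_sub, eval_X, eval_C]
    induction hv using Submodule.span_induction with
    | mem x hx => obtain ⟨j, rfl⟩ := hx; exact hrec j n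
    | zero => simp
    | add x y _ _ hx hy => rw [map_add, map_add, mul_add, mul_add, hx, hy]
    | smul a x _ hx =>
      rw [map_smul, map_smul, smul_eq_mul, smul_eq_mul]
      linear_combination a * hx
  have hode : ∀ v ∈ V, ∑ i ∈ Finset.range (r + 2), (C (P.coeff i) - X * C (Q.coeff i)) *
      (1 - X) ^ (r + 1 - i) * eulerNumerator κ v i = 0 := fun v hv =>
    sum_eulerNumerator_eq_zero (mk_divCoeff_mul κ v) hP1 hQ1 hP0 (hrecV v hv)
  have hreg : ∀ z : ℂ, z ≠ 0 → z ≠ 1 → ∀ v ∈ V, v ≠ 0 → v.rootMultiplicity z ≤ r :=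
    fun z h0 h1 v hv hv0 => rootMultiplicity_le_of_ode hv0 hP2 hQ2 (hode v hv) h0 h1
  have hzero : exponentsAt V 0 = expo n₀ '' Set.Iic r := by
    obtain ⟨h1, h2⟩ := exponentsAt_finite_ncard V 0
    refine eq_image_of_image_subset _ h1 (h2.trans hrank) hd.injective.injOn ?_
    rintro _ ⟨i, hi, rfl⟩
    have hi' : i < r + 1 := Nat.lt_succ_of_le hi
    obtain ⟨h3, h4⟩ := hw.rootMultiplicity_zero ⟨i, hi'⟩
    exact ⟨_, Submodule.subset_span ⟨⟨i, hi'⟩, rfl⟩, h3, h4⟩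
  have hexp1 : exponentsAt V 1 = expo n₁ '' Set.Iic r := by
    obtain ⟨-, h2⟩ := exponentsAt_finite_ncard V 1
    refine eq_image_of_subset_image _ (h2.trans hrank) ?_
    rintro _ ⟨v, hv, hv0, rfl⟩
    refine hone _ ?_
    have := indicial_eq_zero_of_ode hv0 hP2 hQ2 (hode v hv)
    rw [hP3, hQ3] at this
    rw [← this]
    ring
  have hbase : ∀ z : ℂ, 0 ∈ exponentsAt V z → ∃ f ∈ V, f.eval z ≠ 0 := by
    rintro z ⟨f, hf, hf0, hz⟩
    exact ⟨f, hf, fun h => by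
      have := (rootMultiplicity_pos hf0).2 h
      omega⟩
  refine ⟨hfin, hrank, fun z => hbase z ?_, ?_, hzero, hexp1, ?_⟩
  · by_cases h0 : z = 0
    · rw [h0, hzero]
      exact ⟨0, by simp, expo_zero _⟩
    by_cases h1 : z = 1
    · rw [h1, hexp1]
      exact ⟨0, by simp, expo_zero _⟩
    have : exponentsAt V z = id '' Set.Iic r := by
      obtain ⟨-, h2⟩ := exponentsAt_finite_ncard V z
      refine eq_image_of_subset_image _ (h2.trans hrank) ?_
      rintro _ ⟨v, hv, hv0, rfl⟩
      simpa using hreg z h0 h1 v hv hv0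
    rw [this]
    simp
  · intro z hz
    by_contra! hcon
    obtain ⟨f, hf, hf0, hr⟩ := exists_of_isSingularPoint hrank hz
    have := hreg z hcon.1 hcon.2 f hf hf0
    omega
  · obtain ⟨h1, h2⟩ := exponentsAtInfty_finite_ncard V
    refine eq_image_of_image_subset _ h1 (h2.trans hrank) he ?_
    rintro _ ⟨i, hi, rfl⟩
    exact hdeg i hi

/-- Cutting a solution of the recursion at the points `d j` gives solutions. -/
theorem block_recursion {r : ℕ} {d : ℕ → ℕ} {ε : ℕ → ℂ} {c : ℕ → ℂ}
    (hc : ∀ n : ℕ, (∏ i ∈ Finset.range (r + 1), ((n : ℂ) + 1 - d i)) * c (n + 1) =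
      (∏ i ∈ Finset.range (r + 1), ((n : ℂ) - ε i)) * c n) {j : ℕ} (hj : j ≤ r)
    {b : ℕ → ℂ} (hb : ∀ n, InBlock r d j n → b n = c n) (hb0 : ∀ n, ¬ InBlock r d j n → b n = 0)
    (n : ℕ) : (∏ i ∈ Finset.range (r + 1), ((n : ℂ) + 1 - d i)) * b (n + 1) =
      (∏ i ∈ Finset.range (r + 1), ((n : ℂ) - ε i)) * b n := by
  have hcut : ∀ i ≤ r, n + 1 = d i → ∏ i ∈ Finset.range (r + 1), ((n : ℂ) + 1 - d i) = 0 := by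
    intro i hi hn
    refine Finset.prod_eq_zero (i := i) (Finset.mem_range.2 (by omega)) ?_
    rw [← hn]
    push_cast
    ring
  by_cases h1 : InBlock r d j (n + 1) <;> by_cases h2 : InBlock r d j n
  · rw [hb _ h1, hb _ h2, hc]
  -- Entering the block: the left factor vanishes at `n + 1 = d j`, so the new solution may start
  -- there.
  · have hn : n + 1 = d j := by
      unfold InBlock at h1 h2
      omega
    rw [hb0 _ h2, hcut j hj hn]
    ring
  -- Leaving the block: the left factor vanishes, so the recursion for `c` already makes the right
  -- side zero.
  · have hn : j < r ∧ n + 1 = d (j + 1) := by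
      unfold InBlock at h1 h2
      by_contra hcon
      refine h1 ⟨by omega, fun hjr => ?_⟩
      have := h2.2 hjr
      omega
    have := hc n
    rw [hcut (j + 1) (by omega) hn.2, zero_mul] at this
    rw [hb _ h2, hb0 _ h1, mul_zero, this]
  · rw [hb0 _ h1, hb0 _ h2, mul_zero, mul_zero]

/-! ### Exponents `0, …, r - 1, r + k` at `1` -/

/-- A polynomial with at most `N` terms that vanishes at `1` to order `N` is zero. -/
theorem eq_zero_of_support_subset (S : Finset ℕ) (f : ℂ[X]) (hS : ∀ n ∉ S, f.coeff n = 0)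
    (h : (X - C 1) ^ S.card ∣ f) : f = 0 := by
  induction S using Finset.induction_on generalizing f with
  | empty =>
    ext n
    simpa using hS n
  | insert a S ha ih =>
    rw [Finset.card_insert_of_notMem ha] at h
    -- The operator `x d/dx - a` kills the monomial `x^a`, costs at most one order of vanishing at
    -- 1, and kills no other monomial.
    have hco : ∀ n : ℕ, (X * derivative f - C (a : ℂ) * f).coeff n = ((n : ℂ) - a) * f.coeff n := by
      intro n
      rw [coeff_sub, coeff_C_mul]
      cases n with
      | zero => simp
      | succ n =>
        rw [coeff_X_mul, coeff_derivative]
        push_cast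
        ring
    have hg := ih (X * derivative f - C (a : ℂ) * f) (fun n hn => by
      rw [hco]
      by_cases hna : n = a
      · simp [hna]
      · rw [hS n (by simp [hna, hn]), mul_zero]) (dvd_sub
        (Dvd.dvd.mul_left (by simpa using pow_sub_one_dvd_derivative_of_pow_dvd h) _)
        (Dvd.dvd.mul_left ((pow_dvd_pow _ (Nat.le_succ _)).trans h) _))
    have hz : ∀ n : ℕ, n ≠ a → f.coeff n = 0 := by
      intro n hn
      have := hco n
      rw [hg, coeff_zero] at this
      refine (mul_eq_zero.1 this.symm).resolve_left ?_
      exact sub_ne_zero.2 (by exact_mod_cast hn)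
    have hf : f = monomial a (f.coeff a) := by
      ext n
      rw [coeff_monomial]
      split_ifs with hna
      · rw [hna]
      · exact hz n (Ne.symm hna)
    have h1 : f.eval 1 = 0 := dvd_iff_isRoot.1 ((dvd_pow_self _ (Nat.succ_ne_zero _)).trans h)
    rw [hf, eval_monomial, one_pow, mul_one] at h1
    rw [hf, h1, monomial_zero_right]

theorem expo_lastK_of_lt {r k j : ℕ} (hj : j < r) : expo (lastK r k) j = j := by
  unfold expo
  rw [Finset.sum_eq_zero, add_zero]
  intro s hs
  have := (Finset.mem_filter.1 hs).2
  rw [lastK, if_neg (by omega)]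

theorem expo_lastK_self {r : ℕ} (k : ℕ) (hr : 0 < r) : expo (lastK r k) r = r + k := by
  obtain ⟨q, rfl⟩ : ∃ q, r = q + 1 := ⟨r - 1, by omega⟩
  rw [expo_succ (lastK (q + 1) k) ⟨q, by omega⟩]
  simp only [lastK, if_true]
  rw [← expo_lastK_of_lt (r := q + 1) (k := k) (show q < q + 1 by omega)]
  simp [expo_lastK_of_lt]

/-- Exponents `d` at `0` and `e` at infinity with `d 0 ≤ e 0 < d 1 ≤ e 1 < ⋯`. -/
structure IsInterlacing (r k : ℕ) (d e : ℕ → ℕ) : Prop where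
  strictMono : StrictMono d
  zero : d 0 = 0
  le : ∀ i ≤ r, d i ≤ e i
  lt : ∀ i < r, e i < d (i + 1)
  sum : ∑ i ∈ Finset.range (r + 1), e i = ∑ i ∈ Finset.range (r + 1), d i + k

namespace IsInterlacing

variable {r k : ℕ} {d e : ℕ → ℕ}

theorem inBlock (h : IsInterlacing r k d e) {j n : ℕ} (h1 : d j ≤ n) (h2 : n ≤ e j) :
    InBlock r d j n := ⟨h1, fun hj => h2.trans_lt (h.lt j hj)⟩

theorem strictMonoOn (h : IsInterlacing r k d e) : StrictMonoOn e (Set.Iic r) := by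
  intro i hi j hj hij
  have h1 := h.lt i (lt_of_lt_of_le hij hj)
  have h2 := h.strictMono.monotone (show i + 1 ≤ j by omega)
  have h3 := h.le j hj
  omega

theorem card_le (h : IsInterlacing r k d e) :
    ((Finset.range (r + 1)).biUnion fun j => Finset.Icc (d j) (e j)).card ≤ r + k + 1 := by
  refine Finset.card_biUnion_le.trans ?_
  have h1 : ∑ j ∈ Finset.range (r + 1), (Finset.Icc (d j) (e j)).card +
      ∑ j ∈ Finset.range (r + 1), d j = ∑ j ∈ Finset.range (r + 1), e j + (r + 1) := by
    have h2 : ∑ j ∈ Finset.range (r + 1), 1 = r + 1 := by simp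
    rw [← Finset.sum_add_distrib]
    refine Eq.trans ?_ ((Finset.sum_add_distrib (f := e) (g := fun _ => 1)).trans (by rw [h2]))
    refine Finset.sum_congr rfl fun j hj => ?_
    have := h.le j (Nat.lt_succ_iff.1 (Finset.mem_range.1 hj))
    rw [Nat.card_Icc]
    omega
  have := h.sum
  omega

/-- The intervals `[d i, e i]` contain at most `r + k + 1` integers; without `d j` at most `r + k`
terms remain, too few for a zero of order `r + k` at 1. -/
theorem eq_zero_of_dvd (h : IsInterlacing r k d e) {f : ℂ[X]}
    (hf : ∀ n, f.coeff n ≠ 0 → ∃ j ≤ r, d j ≤ n ∧ n ≤ e j) (hdvd : (X - C 1) ^ (r + k) ∣ f)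
    {j : ℕ} (hj : j ≤ r) (h0 : f.coeff (d j) = 0) : f = 0 := by
  classical
  set S := (Finset.range (r + 1)).biUnion fun j => Finset.Icc (d j) (e j)
  have hmem : d j ∈ S :=
    Finset.mem_biUnion.2 ⟨j, Finset.mem_range.2 (by omega), Finset.mem_Icc.2 ⟨le_rfl, h.le j hj⟩⟩
  refine eq_zero_of_support_subset (S.erase (d j)) f ?_ ((pow_dvd_pow _ ?_).trans hdvd)
  · intro n hn
    by_contra hn0
    obtain ⟨i, hi, h1, h2⟩ := hf n hn0
    refine hn (Finset.mem_erase.2 ⟨fun h => hn0 (h ▸ h0), Finset.mem_biUnion.2 ⟨i, ?_, ?_⟩⟩)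
    · exact Finset.mem_range.2 (by omega)
    · exact Finset.mem_Icc.2 ⟨h1, h2⟩
  · rw [Finset.card_erase_of_mem hmem]
    have : S.card ≤ r + k + 1 := h.card_le
    omega

theorem eq_smul_of_dvd (h : IsInterlacing r k d e) {f g : ℂ[X]}
    (hf : ∀ n, f.coeff n ≠ 0 → ∃ j ≤ r, d j ≤ n ∧ n ≤ e j)
    (hg : ∀ n, g.coeff n ≠ 0 → ∃ j ≤ r, d j ≤ n ∧ n ≤ e j)
    (hfd : (X - C 1) ^ (r + k) ∣ f) (hgd : (X - C 1) ^ (r + k) ∣ g) (hf0 : f ≠ 0) :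
    ∃ c : ℂ, g = c • f := by
  have h0 : f.coeff (d 0) ≠ 0 := fun h0 => hf0 (h.eq_zero_of_dvd hf hfd (Nat.zero_le r) h0)
  refine ⟨g.coeff (d 0) / f.coeff (d 0), ?_⟩
  rw [← sub_eq_zero]
  refine h.eq_zero_of_dvd ?_ (dvd_sub hgd (dvd_smul_of_dvd _ hfd)) (Nat.zero_le r) ?_
  · intro n hn
    by_cases hgn : g.coeff n = 0
    · refine hf n fun hfn => hn ?_
      rw [coeff_sub, coeff_smul, hgn, hfn, smul_zero, sub_zero]
    · exact hg n hgn
  · rw [coeff_sub, coeff_smul, smul_eq_mul, div_mul_cancel₀ _ h0, sub_self]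

end IsInterlacing

open Classical in
/-- A solution of `∏ (n + 1 - d i) c_{n+1} = ∏ (n - e i) c_n` with `c_n = 1` for `n = d i`. -/
noncomputable def interlacingSeq (r : ℕ) (d e : ℕ → ℕ) : ℕ → ℂ
  | 0 => 1
  | n + 1 => if ∃ i ≤ r, d i = n + 1 then 1 else
      (∏ i ∈ Finset.range (r + 1), ((n : ℂ) - e i)) /
        (∏ i ∈ Finset.range (r + 1), ((n : ℂ) + 1 - d i)) * interlacingSeq r d e n

section

variable {r k : ℕ} {d e : ℕ → ℕ}

theorem interlacingSeq_left {j : ℕ} (hj : j ≤ r) : interlacingSeq r d e (d j) = 1 := by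
  cases hn : d j with
  | zero => rfl
  | succ n => rw [interlacingSeq, if_pos ⟨j, hj, hn⟩]

theorem interlacingSeq_succ {n : ℕ} (hn : ∀ i ≤ r, d i ≠ n + 1) :
    interlacingSeq r d e (n + 1) = (∏ i ∈ Finset.range (r + 1), ((n : ℂ) - e i)) /
        (∏ i ∈ Finset.range (r + 1), ((n : ℂ) + 1 - d i)) * interlacingSeq r d e n := by
  rw [interlacingSeq, if_neg]
  rintro ⟨i, hi, h⟩
  exact hn i hi h

theorem prod_succ_sub_ne_zero {n : ℕ} (hn : ∀ i ≤ r, d i ≠ n + 1) :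
    ∏ i ∈ Finset.range (r + 1), ((n : ℂ) + 1 - d i) ≠ 0 := by
  refine Finset.prod_ne_zero_iff.2 fun i hi h => ?_
  have hi' := Nat.lt_succ_iff.1 (Finset.mem_range.1 hi)
  rw [sub_eq_zero] at h
  exact hn i hi' (by exact_mod_cast h.symm)

theorem interlacingSeq_ne_zero (h : IsInterlacing r k d e) {j : ℕ} (hj : j ≤ r) {n : ℕ}
    (h1 : d j ≤ n) (h2 : n ≤ e j) : interlacingSeq r d e n ≠ 0 := by
  induction n, h1 using Nat.le_induction with
  | base => rw [interlacingSeq_left hj]; exact one_ne_zero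
  | succ n h1 ih =>
    have hb := h.inBlock h1 (by omega : n ≤ e j)
    have hn : ∀ i ≤ r, d i ≠ n + 1 := by
      intro i hi hin
      have := (inBlock_self r h.strictMono i).eq h.strictMono hi hj
        (hin ▸ h.inBlock (by omega : d j ≤ n + 1) h2)
      subst this
      omega
    rw [interlacingSeq_succ hn]
    refine mul_ne_zero (div_ne_zero ?_ (prod_succ_sub_ne_zero hn)) (ih (by omega))
    refine Finset.prod_ne_zero_iff.2 fun i hi h0 => ?_
    have hi' := Nat.lt_succ_iff.1 (Finset.mem_range.1 hi)
    rw [sub_eq_zero, Nat.cast_inj] at h0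
    have hie := h.inBlock (h.le i hi') le_rfl
    rw [← h0] at hie
    have := hie.eq h.strictMono hi' hj hb
    subst this
    omega

theorem interlacingSeq_eq_zero (h : IsInterlacing r k d e) {j : ℕ} (hj : j ≤ r) {n : ℕ}
    (h1 : e j < n) (h2 : InBlock r d j n) : interlacingSeq r d e n = 0 := by
  induction n, h1 using Nat.le_induction with
  | base =>
    have hn : ∀ i ≤ r, d i ≠ e j + 1 := by
      intro i hi hin
      have := (inBlock_self r h.strictMono i).eq h.strictMono hi hj (hin ▸ h2)
      subst this
      have := h.le i hi
      omega
    rw [interlacingSeq_succ hn, Finset.prod_eq_zero (Finset.mem_range.2 (Nat.lt_succ_of_le hj))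
      (sub_self _), zero_div, zero_mul]
  | succ n h1 ih =>
    have hn : ∀ i ≤ r, d i ≠ n + 1 := by
      intro i hi hin
      have := (inBlock_self r h.strictMono i).eq h.strictMono hi hj (hin ▸ h2)
      subst this
      have := h.le i hi
      omega
    have hb : InBlock r d j n := by
      have := h.le j hj
      exact ⟨by omega, fun hjr => by have := h2.2 hjr; omega⟩
    rw [interlacingSeq_succ hn, ih hb, mul_zero]

theorem interlacingSeq_recursion (h : IsInterlacing r k d e) (n : ℕ) :
    (∏ i ∈ Finset.range (r + 1), ((n : ℂ) + 1 - d i)) * interlacingSeq r d e (n + 1) =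
      (∏ i ∈ Finset.range (r + 1), ((n : ℂ) - e i)) * interlacingSeq r d e n := by
  by_cases hn : ∀ i ≤ r, d i ≠ n + 1
  · rw [interlacingSeq_succ hn]
    field_simp [prod_succ_sub_ne_zero hn]
  · push Not at hn
    obtain ⟨i, hi, hin⟩ := hn
    obtain ⟨j, rfl⟩ : ∃ j, i = j + 1 := by
      refine ⟨i - 1, ?_⟩
      have : i ≠ 0 := fun h0 => by
        rw [h0, h.zero] at hin
        omega
      omega
    rw [Finset.prod_eq_zero (i := j + 1) (Finset.mem_range.2 (by omega))
      (by rw [hin]; push_cast; ring), zero_mul]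
    have hlt := h.lt j (by omega)
    -- Here `n + 1 = d (j + 1)` and the left side is zero. On the right either the factor `n - e j`
    -- vanishes or the sequence has already died after `e j`.
    rcases (show n = e j ∨ e j < n by omega) with hne | hne
    · rw [Finset.prod_eq_zero (i := j) (Finset.mem_range.2 (by omega)) (by rw [hne, sub_self]),
        zero_mul]
    · rw [interlacingSeq_eq_zero h (by omega : j ≤ r) hne, mul_zero]
      have := h.le j (by omega)
      exact ⟨by omega, fun _ => by omega⟩

end

theorem exists_isTwoPointSpace_lastK {r k : ℕ} (hr : 0 < r) {n₀ : Fin r → ℕ} {e : ℕ → ℕ}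
    (h : IsInterlacing r k (expo n₀) e) :
    ∃ U : Submodule ℂ ℂ[X], IsTwoPointSpace r n₀ (lastK r k) e U := by
  set d := expo n₀
  set c := interlacingSeq r d e
  set w : Fin (r + 1) → ℂ[X] := fun j => ∑ n ∈ Finset.Icc (d j) (e j), monomial n (c n)
  have hcoeff : ∀ (j : Fin (r + 1)) (n : ℕ),
      (w j).coeff n = if n ∈ Finset.Icc (d j) (e j) then c n else 0 := by
    intro j n
    simp only [w, finsetSum_coeff, coeff_monomial, Finset.sum_ite_eq']
  have hin : ∀ (j : Fin (r + 1)) (n : ℕ), InBlock r d j n → (w j).coeff n = c n := by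
    intro j n hn
    rw [hcoeff]
    split_ifs with hmem
    · rfl
    · rw [Finset.mem_Icc, not_and, not_le] at hmem
      exact (interlacingSeq_eq_zero h (by omega) (hmem hn.1) hn).symm
  have hout : ∀ (j : Fin (r + 1)) (n : ℕ), ¬ InBlock r d j n → (w j).coeff n = 0 := by
    intro j n hn
    rw [hcoeff, if_neg]
    intro hmem
    rw [Finset.mem_Icc] at hmem
    exact hn (h.inBlock hmem.1 hmem.2)
  refine ⟨_, isTwoPointSpace_span (κ := 0) (w := w) (fun i => (e i : ℂ)) ⟨?_, ?_⟩ ?_ ?_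
    h.strictMonoOn.injOn ?_⟩
  · intro j n hn
    rw [divCoeff_zero] at hn
    exact not_imp_comm.1 (hout j n) hn
  · intro j
    rw [divCoeff_zero, hin j _ (inBlock_self r h.strictMono _)]
    exact interlacingSeq_ne_zero h (by omega) le_rfl (h.le _ (by omega))
  · intro j n
    simp only [divCoeff_zero]
    exact block_recursion (interlacingSeq_recursion h) (by omega : (j : ℕ) ≤ r)
      (b := fun n => (w j).coeff n) (hin j) (hout j) n
  · intro s hs
    have hsum : ∑ i ∈ Finset.range (r + 1), (e i : ℂ) =
        ∑ i ∈ Finset.range (r + 1), (d i : ℂ) + k := by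
      exact_mod_cast h.sum
    rw [hsum] at hs
    rcases mul_eq_zero.1 hs with hs | hs
    · refine ⟨r, by simp, ?_⟩
      rw [expo_lastK_self k hr]
      have : (s : ℂ) = (r + k : ℕ) := by
        push_cast at hs ⊢
        linear_combination -hs
      exact_mod_cast this.symm
    · obtain ⟨i, hi, h0⟩ := Finset.prod_eq_zero_iff.1 hs
      have hir := Finset.mem_range.1 hi
      refine ⟨i, hir.le, ?_⟩
      rw [expo_lastK_of_lt hir]
      have : (s : ℂ) = (i : ℕ) := by
        push_cast at h0 ⊢
        linear_combination -h0
      exact_mod_cast this.symm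
  · intro i hi
    have hne : (w ⟨i, by omega⟩).coeff (e i) ≠ 0 := by
      rw [hin _ _ (h.inBlock (h.le i hi) le_rfl)]
      exact interlacingSeq_ne_zero h hi (h.le i hi) le_rfl
    refine ⟨w ⟨i, by omega⟩, Submodule.subset_span ⟨_, rfl⟩, fun h0 => hne (by rw [h0, coeff_zero]),
      le_antisymm ?_ (le_natDegree_of_ne_zero hne)⟩
    rw [natDegree_le_iff_coeff_eq_zero]
    intro n hn
    rw [hcoeff, if_neg]
    simp only [Finset.mem_Icc, not_and, not_le]
    exact fun _ => hn

/-- `w j` is supported in `[d j, e j]`, and `∑ w j` vanishes at `1` to order `r + k`. -/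
structure IsFrameU {r : ℕ} (k : ℕ) (d e : ℕ → ℕ) (w : Fin (r + 1) → ℂ[X]) : Prop where
  block : IsBlockFamily 0 d w
  natDegree_le : ∀ j, (w j).natDegree ≤ e j
  dvd : (X - C 1) ^ (r + k) ∣ ∑ j, w j

section

variable {r k : ℕ} {d e : ℕ → ℕ} {w w' : Fin (r + 1) → ℂ[X]}

theorem support_sum (hw : IsBlockFamily 0 d w) (hdeg : ∀ j, (w j).natDegree ≤ e j)
    (c : Fin (r + 1) → ℂ) (n : ℕ) (hn : (∑ j, c j • w j).coeff n ≠ 0) :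
    ∃ j ≤ r, d j ≤ n ∧ n ≤ e j := by
  rw [finsetSum_coeff] at hn
  obtain ⟨j, -, hj⟩ := Finset.exists_ne_zero_of_sum_ne_zero hn
  have hj' : (w j).coeff n ≠ 0 := fun h0 => hj (by rw [coeff_smul, h0, smul_zero])
  refine ⟨j, by omega, (hw.support j n ?_).1, (le_natDegree_of_ne_zero hj').trans (hdeg j)⟩
  rwa [divCoeff_zero]

theorem IsFrameU.sum_ne_zero (hw : IsFrameU k d e w) (hd : StrictMono d) : ∑ j, w j ≠ 0 := by
  intro h0
  have := Fintype.linearIndependent_iff.1 (hw.block.linearIndependent hd) (fun _ => 1)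
    (by simpa using h0) 0
  exact one_ne_zero this

theorem IsFrameU.dvd_sum_iff (hw : IsFrameU k d e w) (h : IsInterlacing r k d e)
    (c : Fin (r + 1) → ℂ) :
    (X - C 1) ^ (r + k) ∣ ∑ j, c j • w j ↔ ∀ i j, c i = c j := by
  constructor
  · intro hdvd
    have hsup := support_sum hw.block hw.natDegree_le
    obtain ⟨a, ha⟩ := h.eq_smul_of_dvd (by simpa using hsup fun _ => 1) (hsup c) hw.dvd hdvd
      (hw.sum_ne_zero h.strictMono)
    have : ∀ j, c j - a = 0 := by
      refine Fintype.linearIndependent_iff.1 (hw.block.linearIndependent h.strictMono) _ ?_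
      simp only [sub_smul, Finset.sum_sub_distrib, ha, Finset.smul_sum, sub_self]
    intro i j
    rw [sub_eq_zero.1 (this i), sub_eq_zero.1 (this j)]
  · intro hc
    have : ∑ j, c j • w j = c 0 • ∑ j, w j := by
      rw [Finset.smul_sum]
      exact Finset.sum_congr rfl fun j _ => by rw [hc j 0]
    rw [this]
    exact dvd_smul_of_dvd _ hw.dvd

/-- As `e i < d (i + 1)`, a later block can contribute nothing in degree at most `e i`, and blocks
do not interfere. -/
theorem IsFrameU.degree_sum_le_iff (hw : IsFrameU k d e w) (h : IsInterlacing r k d e)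
    (c : Fin (r + 1) → ℂ) {i : ℕ} (hi : i ≤ r) :
    (∑ j, c j • w j).natDegree ≤ e i ↔ ∀ j : Fin (r + 1), i < j → c j = 0 := by
  constructor
  · intro hdeg j hj
    have h1 := hw.block.divCoeff_sum h.strictMono c (inBlock_self r h.strictMono j)
    have h2 := h.lt i (by omega)
    have h3 := h.strictMono.monotone (show i + 1 ≤ j by omega)
    rw [divCoeff_zero, coeff_eq_zero_of_natDegree_lt (by omega)] at h1
    exact (mul_eq_zero.1 h1.symm).resolve_right (hw.block.ne_zero j)
  · intro hc
    refine natDegree_sum_le_of_forall_le _ _ fun j _ => ?_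
    by_cases hj : i < j
    · rw [hc j hj, zero_smul, natDegree_zero]
      exact Nat.zero_le _
    · exact (natDegree_smul_le _ _).trans ((hw.natDegree_le j).trans
        (h.strictMonoOn.monotoneOn (show (j : ℕ) ≤ r by omega) hi (by omega)))

theorem IsFrameU.eq_smul (hw : IsFrameU k d e w) (hw' : IsFrameU k d e w')
    (h : IsInterlacing r k d e) : ∃ c : ℂ, c ≠ 0 ∧ w' = fun j => c • w j := by
  have hsup := support_sum hw.block hw.natDegree_le fun _ => 1
  have hsup' := support_sum hw'.block hw'.natDegree_le fun _ => 1
  simp only [one_smul] at hsup hsup'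
  obtain ⟨c, hc⟩ := h.eq_smul_of_dvd hsup hsup' hw.dvd hw'.dvd (hw.sum_ne_zero h.strictMono)
  have hc0 : c ≠ 0 := by
    rintro rfl
    exact hw'.sum_ne_zero h.strictMono (by rw [hc, zero_smul])
  refine ⟨c, hc0, hw'.block.eq_of_sum_eq (hw.block.smul fun _ => hc0) h.strictMono ?_⟩
  rw [hc, Finset.smul_sum]

end

theorem exists_isFrameU {r k : ℕ} (hr : 0 < r) {n₀ : Fin r → ℕ} {e : ℕ → ℕ}
    (h : IsInterlacing r k (expo n₀) e) {U : Submodule ℂ ℂ[X]}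
    (hU : IsTwoPointSpace r n₀ (lastK r k) e U) :
    ∃ w : Fin (r + 1) → ℂ[X], IsFrameU k (expo n₀) e w ∧ ∀ j, w j ∈ U := by
  have := hU.finite
  have hd := h.strictMono
  -- The `r` conditions kill the coefficients at `d t` for `t < j` and at `e t` for `t > j`, which
  -- leaves support in `[d j, e j]`.
  have hx : ∀ j : Fin (r + 1), ∃ x ∈ U, x ≠ 0 ∧
      ∀ t : Fin r, lcoeff ℂ (if (t : ℕ) < j then expo n₀ t else e (t + 1)) x = 0 := fun j =>
    exists_ne_zero_of_functionals U (by simp [hU.finrank_eq])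
      fun t : Fin r => lcoeff ℂ (if (t : ℕ) < j then expo n₀ t else e (t + 1))
  choose x hxU hx0 hxt using hx
  have hdvd : ∀ j : Fin (r + 1), X ^ expo n₀ j ∣ x j := by
    intro j
    refine X_pow_dvd_of_coeff_eq_zero hd hU.exponents_zero (hxU j) (hx0 j) fun t ht => ?_
    have := hxt j ⟨t, by omega⟩
    simpa [ht] using this
  have hdeg : ∀ j : Fin (r + 1), (x j).natDegree ≤ e j := by
    intro j
    refine natDegree_le_of_coeff_eq_zero h.strictMonoOn.monotoneOn hU.exponents_infty (hxU j)
      (hx0 j) (by omega) fun t ht htr => ?_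
    have := hxt j ⟨t - 1, by omega⟩
    simp only [lcoeff_apply] at this
    rwa [if_neg (by omega), Nat.sub_add_cancel (by omega)] at this
  have hblock : IsBlockFamily 0 (expo n₀) x := by
    refine IsBlockFamily.of_support hd hU.exponents_zero hxU hx0 fun j n hn => ?_
    rw [divCoeff_zero] at hn
    refine h.inBlock ?_ ((le_natDegree_of_ne_zero hn).trans (hdeg j))
    by_contra! hlt
    exact hn (Polynomial.X_pow_dvd_iff.1 (hdvd j) n hlt)
  -- An element of maximal order at 1 has all coordinates nonzero, because a missing block would
  -- leave too few terms; rescaling by its coordinates gives the frame.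
  obtain ⟨p, hpU, hp0, hp⟩ : expo (lastK r k) r ∈ exponentsAt U 1 := by
    rw [hU.exponents_one]
    exact ⟨r, by simp, rfl⟩
  rw [expo_lastK_self k hr] at hp
  have hpd : (X - C 1) ^ (r + k) ∣ p := hp ▸ pow_rootMultiplicity_dvd p 1
  obtain ⟨c, rfl⟩ := hblock.exists_sum_eq hd hU.finrank_eq hxU hpU
  have hc : ∀ j, c j ≠ 0 := by
    intro j hcj
    refine hp0 (h.eq_zero_of_dvd (support_sum hblock hdeg c) hpd (by omega : (j : ℕ) ≤ r) ?_)
    have := hblock.divCoeff_sum hd c (inBlock_self r hd j)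
    rw [divCoeff_zero] at this
    rw [this, hcj, zero_mul]
  exact ⟨fun j => c j • x j, ⟨hblock.smul hc, fun j => (natDegree_smul_le _ _).trans (hdeg j), hpd⟩,
    fun j => U.smul_mem _ (hxU j)⟩

/-! ### Exponents `0, k + 1, …, k + r` at `1` -/

theorem expo_firstK {r k j : ℕ} (h0 : 0 < j) (hj : j ≤ r) : expo (firstK r k) j = j + k := by
  unfold expo
  rw [Finset.sum_eq_single_of_mem (⟨0, by omega⟩ : Fin r) (by simpa using h0)]
  · simp [firstK]
  · intro s _ hs
    rw [firstK, if_neg]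
    exact fun h => hs (Fin.ext h)

/-- Exponents `d` at `0` and `e = d + k - lam` at infinity, where the numbers `lam` sum up to `k`
and the sets `[d i - lam i, d i)` and `{d 0, …, d r}` are disjoint. -/
structure IsGapped (r k : ℕ) (d lam e : ℕ → ℕ) : Prop where
  strictMono : StrictMono d
  zero : d 0 = 0
  lt : ∀ i < r, d i + lam (i + 1) < d (i + 1)
  sum : ∑ i ∈ Finset.range (r + 1), lam i = k
  add : ∀ i ≤ r, e i + lam i = d i + k

/-- The indices `(i, j)` of the gap points `d i - (j + 1)`. -/
def gapIndex (r : ℕ) (lam : ℕ → ℕ) : Finset (Σ _ : ℕ, ℕ) :=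
  (Finset.range (r + 1)).sigma fun i => Finset.range (lam i)

theorem mem_gapIndex {r : ℕ} {lam : ℕ → ℕ} {x : Σ _ : ℕ, ℕ} :
    x ∈ gapIndex r lam ↔ x.1 ≤ r ∧ x.2 < lam x.1 := by
  rw [gapIndex, Finset.mem_sigma, Finset.mem_range, Finset.mem_range, Nat.lt_succ_iff]

/-- The monic polynomial whose roots are the gap points. -/
noncomputable def gapPoly (r : ℕ) (d lam : ℕ → ℕ) : ℂ[X] :=
  ∏ x ∈ gapIndex r lam, (X - C ((d x.1 : ℂ) - (x.2 + 1)))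

theorem gapPoly_ne_zero (r : ℕ) (d lam : ℕ → ℕ) : gapPoly r d lam ≠ 0 :=
  (monic_prod_of_monic _ _ fun _ _ => monic_X_sub_C _).ne_zero

theorem gapPoly_eval_eq_zero_iff {r : ℕ} {d lam : ℕ → ℕ} {z : ℂ} :
    (gapPoly r d lam).eval z = 0 ↔ ∃ i ≤ r, ∃ j < lam i, z = (d i : ℂ) - (j + 1) := by
  rw [gapPoly, eval_prod, Finset.prod_eq_zero_iff]
  simp only [eval_sub, eval_X, eval_C, sub_eq_zero (a := z)]
  constructor
  · rintro ⟨x, hx, h⟩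
    rw [mem_gapIndex] at hx
    exact ⟨x.1, hx.1, x.2, hx.2, h⟩
  · rintro ⟨i, hi, j, hj, h⟩
    exact ⟨⟨i, j⟩, mem_gapIndex.2 ⟨hi, hj⟩, h⟩

theorem gapPoly_eval_natCast_eq_zero_iff {r : ℕ} {d lam : ℕ → ℕ} {n : ℕ} :
    (gapPoly r d lam).eval (n : ℂ) = 0 ↔ ∃ i ≤ r, ∃ j < lam i, n + (j + 1) = d i := by
  rw [gapPoly_eval_eq_zero_iff]
  refine exists_congr fun i => and_congr_right fun _ => exists_congr fun j =>
    and_congr_right fun _ => ?_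
  rw [eq_sub_iff_add_eq]
  exact_mod_cast Iff.rfl

/-- For each `i` separately the shift moves a run of `lam i` consecutive roots by one, so all
factors but the two end ones cancel. -/
theorem gapPoly_recursion (r : ℕ) (d lam : ℕ → ℕ) (z : ℂ) :
    (∏ i ∈ Finset.range (r + 1), (z + 1 - d i)) * (gapPoly r d lam).eval (z + 1) =
      (∏ i ∈ Finset.range (r + 1), (z - ((d i : ℂ) - lam i - 1))) * (gapPoly r d lam).eval z := by
  rw [gapPoly, gapIndex, Finset.prod_sigma, eval_prod, eval_prod, ← Finset.prod_mul_distrib,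
    ← Finset.prod_mul_distrib]
  refine Finset.prod_congr rfl fun i _ => ?_
  rw [eval_prod, eval_prod]
  simp only [eval_sub, eval_X, eval_C]
  have h1 := Finset.prod_range_succ (fun j : ℕ => z + 1 - d i + j) (lam i)
  rw [Finset.prod_range_succ'] at h1
  have h2 : ∏ j ∈ Finset.range (lam i), (z + 1 - ((d i : ℂ) - (j + 1))) =
      ∏ j ∈ Finset.range (lam i), (z + 1 - d i + ((j + 1 : ℕ) : ℂ)) :=
    Finset.prod_congr rfl fun j _ => by push_cast; ring
  have h3 : ∏ j ∈ Finset.range (lam i), (z - ((d i : ℂ) - (j + 1))) =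
      ∏ j ∈ Finset.range (lam i), (z + 1 - d i + (j : ℂ)) :=
    Finset.prod_congr rfl fun j _ => by ring
  rw [h2, h3]
  push_cast at h1 ⊢
  linear_combination h1

/-- The values at natural numbers of a polynomial determine it. -/
theorem eq_of_eval_natCast_eq {f g : ℂ[X]} (h : ∀ n : ℕ, f.eval (n : ℂ) = g.eval (n : ℂ)) :
    f = g := by
  refine eq_of_infinite_eval_eq f g
    ((Set.infinite_range_of_injective (Nat.cast_injective (R := ℂ))).mono ?_)
  rintro _ ⟨n, rfl⟩
  exact h n

/-- The polynomial in `n` that gives the `n`-th coefficient of `x^i / (1 - x)^(k + 1)`. -/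
noncomputable def shiftedChoose (k i : ℕ) : ℂ[X] :=
  C ((k.factorial : ℂ)⁻¹) * ∏ j ∈ Finset.range k, (X - C ((i : ℂ) - (j + 1)))

theorem shiftedChoose_eval {k i : ℕ} (hi : i ≤ k) (n : ℕ) :
    (shiftedChoose k i).eval (n : ℂ) = divCoeff (k + 1) n (X ^ i) := by
  have h1 : divCoeff (k + 1) n (X ^ i) = if i ≤ n then ((k + (n - i)).choose k : ℂ) else 0 := by
    have : divCoeff (k + 1) n (X ^ i) = PowerSeries.coeff n (((X ^ i : ℂ[X]) : PowerSeries ℂ) *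
      ((PowerSeries.invOneSubPow ℂ (k + 1) : (PowerSeries ℂ)ˣ) : PowerSeries ℂ)) := rfl
    rw [this, PowerSeries.invOneSubPow_val_succ_eq_mk_add_choose, Polynomial.coe_pow,
      Polynomial.coe_X, PowerSeries.coeff_X_pow_mul']
    simp
  rw [h1, shiftedChoose, eval_mul, eval_C, eval_prod]
  simp only [eval_sub, eval_X, eval_C]
  split_ifs with hin
  · obtain ⟨m, rfl⟩ := Nat.exists_eq_add_of_le hin
    have h2 : ∏ j ∈ Finset.range k, (((i + m : ℕ) : ℂ) - ((i : ℂ) - (j + 1))) =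
        ((m + 1).ascFactorial k : ℕ) := by
      rw [Nat.ascFactorial_eq_prod_range, Nat.cast_prod]
      refine Finset.prod_congr rfl fun j _ => ?_
      push_cast
      ring
    rw [h2, Nat.ascFactorial_eq_factorial_mul_choose, Nat.cast_mul, ← mul_assoc,
      inv_mul_cancel₀ (by exact_mod_cast k.factorial_ne_zero), one_mul, Nat.add_sub_cancel_left,
      Nat.add_comm m k]
  -- For `n < i` the polynomial vanishes as the coefficient does: `n` is one of its roots `i - 1, …,
  -- i - k`, because `i ≤ k`.
  · rw [Finset.prod_eq_zero (i := i - n - 1) (Finset.mem_range.2 (by omega)), mul_zero]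
    have : i = n + (i - n - 1) + 1 := by omega
    have h2 : (i : ℂ) = n + ((i - n - 1 : ℕ) : ℂ) + 1 := by exact_mod_cast this
    rw [h2]
    ring

/-- The coefficients of `p / (1 - x)^(k + 1)`, `deg p ≤ k`, are the values of a polynomial of
degree at most `k`, which vanishes at `-1, …, -L` if `deg p ≤ k - L`. -/
theorem exists_eval_eq_divCoeff {k L : ℕ} {p : ℂ[X]} (hp : p.natDegree + L ≤ k) :
    ∃ S : ℂ[X], S.natDegree ≤ k ∧ (∀ n : ℕ, S.eval (n : ℂ) = divCoeff (k + 1) n p) ∧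
      ∀ t < L, S.eval (0 - ((t : ℂ) + 1)) = 0 := by
  refine ⟨∑ i ∈ Finset.range (p.natDegree + 1), C (p.coeff i) * shiftedChoose k i, ?_, ?_, ?_⟩
  · refine natDegree_sum_le_of_forall_le _ _ fun i _ => (natDegree_C_mul_le _ _).trans
      ((natDegree_C_mul_le _ _).trans ?_)
    rw [natDegree_prod_of_monic _ _ fun j _ => monic_X_sub_C _]
    simp only [natDegree_X_sub_C, Finset.sum_const, Finset.card_range, smul_eq_mul, mul_one, le_rfl]
  · intro n
    conv_rhs => rw [p.as_sum_range_C_mul_X_pow]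
    rw [eval_finsetSum, map_sum]
    refine Finset.sum_congr rfl fun i hi => ?_
    have := Finset.mem_range.1 hi
    rw [eval_mul, eval_C, shiftedChoose_eval (by omega), ← smul_eq_C_mul, map_smul, smul_eq_mul]
  · intro t ht
    rw [eval_finsetSum]
    refine Finset.sum_eq_zero fun i hi => ?_
    have := Finset.mem_range.1 hi
    rw [eval_mul, shiftedChoose, eval_mul, eval_prod,
      Finset.prod_eq_zero (i := i + t) (Finset.mem_range.2 (by omega)), mul_zero, mul_zero]
    simp only [eval_sub, eval_X, eval_C]
    push_cast
    ring

theorem exists_inBlock (r : ℕ) {d : ℕ → ℕ} (h0 : d 0 = 0) (n : ℕ) : ∃ j ≤ r, InBlock r d j n := by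
  induction r with
  | zero => exact ⟨0, le_rfl, by omega, fun h => absurd h (lt_irrefl 0)⟩
  | succ r ih =>
    obtain ⟨j, hj, h1, h2⟩ := ih
    rcases Nat.lt_or_ge n (d (r + 1)) with h | h
    · refine ⟨j, by omega, h1, fun _ => ?_⟩
      rcases hj.lt_or_eq with hjr | rfl
      · exact h2 hjr
      · exact h
    · exact ⟨r + 1, le_rfl, h, fun h' => absurd h' (lt_irrefl _)⟩

namespace IsGapped

variable {r k : ℕ} {d lam e : ℕ → ℕ}

theorem strictMonoOn (h : IsGapped r k d lam e) : StrictMonoOn e (Set.Iic r) := by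
  intro i hi j hj hij
  rw [Set.mem_Iic] at hi hj
  obtain ⟨q, rfl⟩ : ∃ q, j = q + 1 := ⟨j - 1, by omega⟩
  have h1 := h.lt q (by omega)
  have h2 := h.strictMono.monotone (show i ≤ q by omega)
  have h3 := h.add i hi
  have h4 := h.add (q + 1) hj
  omega

theorem e_zero (h : IsGapped r k d lam e) : e 0 + lam 0 = k := by
  rw [h.add 0 (Nat.zero_le r), h.zero, zero_add]

theorem gapPoly_eval_ne_zero (h : IsGapped r k d lam e) {j : ℕ} (hj : j ≤ r) {n : ℕ}
    (h1 : d j ≤ n) (h2 : j < r → n + lam (j + 1) < d (j + 1)) :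
    (gapPoly r d lam).eval (n : ℂ) ≠ 0 := by
  rw [Ne, gapPoly_eval_natCast_eq_zero_iff]
  rintro ⟨i, hi, t, ht, hn⟩
  have hij : j < i := by
    by_contra! hle
    have := h.strictMono.monotone hle
    omega
  have h3 := h2 (by omega)
  rcases (show j + 1 = i ∨ j + 1 ≤ i - 1 ∧ 1 ≤ i by omega) with rfl | ⟨h4, h5⟩
  · omega
  · have h6 := h.strictMono.monotone h4
    have h7 := h.lt (i - 1) (by omega)
    rw [Nat.sub_add_cancel h5] at h7
    omega

theorem gapPoly_eval_left (h : IsGapped r k d lam e) {j : ℕ} (hj : j ≤ r) :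
    (gapPoly r d lam).eval (d j : ℂ) ≠ 0 :=
  h.gapPoly_eval_ne_zero hj le_rfl (h.lt j)

theorem gapPoly_natDegree (h : IsGapped r k d lam e) : (gapPoly r d lam).natDegree = k := by
  rw [gapPoly, natDegree_prod_of_monic _ _ fun _ _ => monic_X_sub_C _]
  simp only [natDegree_X_sub_C, Finset.sum_const, smul_eq_mul, mul_one, gapIndex,
    Finset.card_sigma, Finset.card_range, h.sum]

/-- The gap points are pairwise distinct: for `i ≥ 1` those below `d i` lie strictly between `d (i -
1)` and `d i`, and those for `i = 0` are negative. -/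
theorem gapPoly_dvd (h : IsGapped r k d lam e) {S : ℂ[X]}
    (hS : ∀ i ≤ r, ∀ j < lam i, S.eval ((d i : ℂ) - (j + 1)) = 0) : gapPoly r d lam ∣ S := by
  refine Finset.prod_dvd_of_coprime ?_ fun x hx => ?_
  · rintro ⟨i, j⟩ hx ⟨i', j'⟩ hy hxy
    have hx' := mem_gapIndex.1 (Finset.mem_coe.1 hx)
    have hy' := mem_gapIndex.1 (Finset.mem_coe.1 hy)
    simp only at hx' hy'
    refine isCoprime_X_sub_C_of_isUnit_sub (IsUnit.mk0 _ fun h0 => hxy ?_)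
    have h1 : d i + j' = d i' + j := by
      have : (d i : ℂ) + j' = d i' + j := by linear_combination h0
      exact_mod_cast this
    have key : ∀ a b s t : ℕ, a < b → b ≤ r → t < lam b → d a + t ≠ d b + s := by
      intro a b s t hab hb ht hne
      have h3 := h.lt (b - 1) (by omega)
      rw [Nat.sub_add_cancel (by omega)] at h3
      have h4 := h.strictMono.monotone (show a ≤ b - 1 by omega)
      omega
    rcases lt_trichotomy i i' with hii | rfl | hii
    · exact absurd h1 (key i i' j j' hii hy'.1 hy'.2)
    · have : j = j' := by omega
      rw [this]
    · exact absurd h1.symm (key i' i j' j hii hx'.1 hx'.2)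
  · have hx' := mem_gapIndex.1 hx
    exact dvd_iff_isRoot.2 (hS _ hx'.1 _ hx'.2)

/-- The interpolating polynomial has degree at most `k` and vanishes at all `k` gap points. Those
with `i = 0`, namely `-1, …, -lam 0`, come from `deg p ≤ k - lam 0` rather than from `hgap`. -/
theorem divCoeff_eq_gapPoly (h : IsGapped r k d lam e) {p : ℂ[X]} (hp : p.natDegree ≤ e 0)
    (hgap : ∀ i ≤ r, ∀ j < lam i, ∀ n : ℕ, n + (j + 1) = d i → divCoeff (k + 1) n p = 0) :
    ∃ a : ℂ, (∀ n, divCoeff (k + 1) n p = a * (gapPoly r d lam).eval (n : ℂ)) ∧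
      (p ≠ 0 → a ≠ 0) := by
  have he := h.e_zero
  obtain ⟨S, hS1, hS2, hS3⟩ := exists_eval_eq_divCoeff (p := p) (k := k) (L := lam 0) (by omega)
  obtain ⟨q, hq⟩ := h.gapPoly_dvd (S := S) (by
    intro i hi j hj
    rcases Nat.eq_zero_or_pos i with rfl | hi0
    · rw [h.zero, Nat.cast_zero]
      exact hS3 j hj
    · have h1 := h.lt (i - 1) (by omega)
      rw [Nat.sub_add_cancel hi0] at h1
      have h2 : (d i - (j + 1)) + (j + 1) = d i := by omega
      have h3 : (d i : ℂ) - (j + 1) = ((d i - (j + 1) : ℕ) : ℂ) := by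
        rw [Nat.cast_sub (by omega)]
        push_cast
        ring
      rw [h3, hS2, hgap i hi j hj _ h2])
  have hq0 : q.natDegree = 0 := by
    by_cases h0 : q = 0
    · simp [h0]
    · rw [hq, natDegree_mul (gapPoly_ne_zero r d lam) h0, h.gapPoly_natDegree] at hS1
      omega
  have heq : ∀ n, divCoeff (k + 1) n p = q.coeff 0 * (gapPoly r d lam).eval (n : ℂ) := by
    intro n
    rw [← hS2, hq, eq_C_of_natDegree_eq_zero hq0, eval_mul, eval_C, mul_comm, coeff_C_zero]
  refine ⟨q.coeff 0, heq, fun hp0 ha => hp0 (eq_of_divCoeff_eq (κ := k + 1) fun n => ?_)⟩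
  rw [heq, ha, zero_mul, map_zero]

/-- A smaller degree would force one more zero of the interpolating polynomial, at `-(lam 0 + 1)`,
which is not a gap point. -/
theorem natDegree_eq (h : IsGapped r k d lam e) {p : ℂ[X]} (hp : p.natDegree ≤ e 0) {a : ℂ}
    (ha : a ≠ 0) (hpa : ∀ n, divCoeff (k + 1) n p = a * (gapPoly r d lam).eval (n : ℂ)) :
    p.natDegree = e 0 := by
  by_contra hne
  have he := h.e_zero
  obtain ⟨S, -, hS2, hS3⟩ := exists_eval_eq_divCoeff (p := p) (k := k) (L := lam 0 + 1) (by omega)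
  have hS : S = C a * gapPoly r d lam := eq_of_eval_natCast_eq fun n => by
    rw [hS2, hpa, eval_mul, eval_C]
  have h1 := hS3 (lam 0) (Nat.lt_succ_self _)
  rw [hS, eval_mul, eval_C] at h1
  obtain ⟨i, hi, j, hj, h2⟩ := gapPoly_eval_eq_zero_iff.1 ((mul_eq_zero.1 h1).resolve_left ha)
  have h3 : d i + lam 0 = j := by
    have : (d i : ℂ) + lam 0 = j := by linear_combination -h2
    exact_mod_cast this
  rcases Nat.eq_zero_or_pos i with rfl | hi0
  · omega
  · have h1 := h.lt (i - 1) (by omega)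
    rw [Nat.sub_add_cancel hi0] at h1
    omega

/-- Polynomials of degree at most `e 0` form a space of dimension `e 0 + 1`, while the gap
conditions with `i ≥ 1` number `k - lam 0 = e 0`. -/
theorem exists_seed (h : IsGapped r k d lam e) : ∃ p : ℂ[X], p ≠ 0 ∧ p.natDegree = e 0 ∧
    ∃ a : ℂ, a ≠ 0 ∧ ∀ n, divCoeff (k + 1) n p = a * (gapPoly r d lam).eval (n : ℂ) := by
  have hfin : Module.finrank ℂ (degreeLT ℂ (e 0 + 1)) = e 0 + 1 := by
    rw [(degreeLTEquiv ℂ (e 0 + 1)).finrank_eq, Module.finrank_fin_fun]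
  have : Module.Finite ℂ (degreeLT ℂ (e 0 + 1)) :=
    Module.Finite.equiv (degreeLTEquiv ℂ (e 0 + 1)).symm
  have hcard : Fintype.card (Σ i : Fin r, Fin (lam (i + 1))) < e 0 + 1 := by
    have h1 := h.sum
    have h2 := h.e_zero
    rw [Finset.sum_range_succ', ← Fin.sum_univ_eq_sum_range (fun i => lam (i + 1))] at h1
    simp only [Fintype.card_sigma, Fintype.card_fin]
    omega
  obtain ⟨p, hp, hp0, hpt⟩ := exists_ne_zero_of_functionals (degreeLT ℂ (e 0 + 1))
    (hfin.symm ▸ hcard) fun x => divCoeff (k + 1) (d (x.1 + 1) - (x.2 + 1))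
  have hdeg : p.natDegree ≤ e 0 := by
    rw [mem_degreeLT] at hp
    exact Nat.lt_succ_iff.1 ((natDegree_lt_iff_degree_lt hp0).2 hp)
  obtain ⟨a, ha, ha0⟩ := h.divCoeff_eq_gapPoly hdeg (by
    intro i hi j hj n hn
    have hi0 : i ≠ 0 := by
      rintro rfl
      rw [h.zero] at hn
      omega
    obtain ⟨q, rfl⟩ : ∃ q, i = q + 1 := ⟨i - 1, by omega⟩
    have := hpt ⟨⟨q, by omega⟩, ⟨j, hj⟩⟩
    simp only at this
    rwa [show d (q + 1) - (j + 1) = n by omega] at this)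
  exact ⟨p, hp0, h.natDegree_eq hdeg (ha0 hp0) ha, a, ha0 hp0, ha⟩

end IsGapped

theorem exists_isTwoPointSpace_firstK {r k : ℕ} {n₀ : Fin r → ℕ} {lam e : ℕ → ℕ}
    (h : IsGapped r k (expo n₀) lam e) :
    ∃ V : Submodule ℂ ℂ[X], IsTwoPointSpace r n₀ (firstK r k) e V := by
  set d := expo n₀ with hd
  obtain ⟨p, hp0, hpe, a, ha, hpa⟩ := h.exists_seed
  set c : ℕ → ℂ := fun n => divCoeff (k + 1) n p with hc
  have hc0 : ∀ n, c n = 0 ↔ (gapPoly r d lam).eval (n : ℂ) = 0 := fun n => by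
    rw [hc]
    simp only [hpa, mul_eq_zero, ha, false_or]
  set g : ℕ → ℕ → ℂ[X] := fun a b => ∑ n ∈ Finset.Ico a b, monomial n (c n) with hg
  have hgc : ∀ a b n, (g a b).coeff n = if n ∈ Finset.Ico a b then c n else 0 := by
    intro a b n
    simp only [hg, finsetSum_coeff, coeff_monomial, Finset.sum_ite_eq']
  -- Finite blocks give multiples of `(1 - X)^(k + 1)`. The last block is an infinite series, whose
  -- numerator is `p` minus the finite part.
  set w : Fin (r + 1) → ℂ[X] := fun j =>
    if (j : ℕ) < r then (1 - X) ^ (k + 1) * g (d j) (d (j + 1)) else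
      p - (1 - X) ^ (k + 1) * g 0 (d r) with hw
  have hwlt : ∀ j : Fin (r + 1), (j : ℕ) < r →
      w j = (1 - X) ^ (k + 1) * g (d j) (d (j + 1)) := fun j hj => if_pos hj
  have hwge : ∀ j : Fin (r + 1), ¬ (j : ℕ) < r →
      w j = p - (1 - X) ^ (k + 1) * g 0 (d r) := fun j hj => if_neg hj
  have hin : ∀ (j : Fin (r + 1)) (n : ℕ), InBlock r d j n → divCoeff (k + 1) n (w j) = c n := by
    intro j n hn
    by_cases hj : (j : ℕ) < r
    · rw [hwlt j hj, divCoeff_pow_mul, hgc, if_pos (Finset.mem_Ico.2 ⟨hn.1, hn.2 hj⟩)]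
    · have hjr : (j : ℕ) = r := by omega
      have := hn.1
      rw [hjr] at this
      rw [hwge j hj, map_sub, divCoeff_pow_mul, hgc, if_neg, sub_zero]
      rw [Finset.mem_Ico]
      omega
  have hout : ∀ (j : Fin (r + 1)) (n : ℕ), ¬ InBlock r d j n → divCoeff (k + 1) n (w j) = 0 := by
    intro j n hn
    by_cases hj : (j : ℕ) < r
    · rw [hwlt j hj, divCoeff_pow_mul, hgc, if_neg]
      intro hmem
      rw [Finset.mem_Ico] at hmem
      exact hn ⟨hmem.1, fun _ => hmem.2⟩
    · have hjr : (j : ℕ) = r := by omega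
      rw [hwge j hj, map_sub, divCoeff_pow_mul, hgc, if_pos, sub_self]
      rw [Finset.mem_Ico]
      by_contra hcon
      refine hn ⟨?_, fun h' => absurd h' hj⟩
      rw [hjr]
      omega
  have hblock : IsBlockFamily (k + 1) d w := by
    refine ⟨fun j n => not_imp_comm.1 (hout j n), fun j => ?_⟩
    rw [hin j _ (inBlock_self r h.strictMono _), Ne, hc0]
    exact h.gapPoly_eval_left (by omega)
  have hsum : ∑ j, w j = p := by
    refine eq_of_divCoeff_eq (κ := k + 1) fun n => ?_
    obtain ⟨j, hj, hn⟩ := exists_inBlock r h.zero n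
    have := hblock.divCoeff_sum h.strictMono (fun _ => 1) (j := ⟨j, by omega⟩) hn
    simp only [one_smul, one_mul] at this
    rw [this, hin _ _ hn]
  refine ⟨_, isTwoPointSpace_span (fun i => (d i : ℂ) - lam i - 1) hblock ?_ ?_
    h.strictMonoOn.injOn ?_⟩
  · intro j n
    refine block_recursion (c := c) (fun n => ?_) (by omega : (j : ℕ) ≤ r)
      (b := fun n => divCoeff (k + 1) n (w j)) (hin j) (hout j) n
    have := gapPoly_recursion r d lam n
    simp only [hc, hpa]
    push_cast
    linear_combination a * this
  · intro s hs
    have hlam : ∑ i ∈ Finset.range (r + 1), (lam i : ℂ) = k := by exact_mod_cast h.sum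
    simp only [Finset.sum_sub_distrib, hlam, Finset.sum_const, Finset.card_range, nsmul_eq_mul,
      mul_one] at hs
    push_cast at hs
    rcases mul_eq_zero.1 hs with hs | hs
    · have : (s : ℂ) = (0 : ℕ) := by
        push_cast
        linear_combination -hs
      rw [Nat.cast_inj] at this
      exact ⟨0, by simp, by rw [expo_zero, this]⟩
    · obtain ⟨i, hi, h0⟩ := Finset.prod_eq_zero_iff.1 hs
      have hir := Finset.mem_range.1 hi
      refine ⟨i + 1, Nat.succ_le_of_lt hir, ?_⟩
      rw [expo_firstK (Nat.succ_pos i) hir]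
      have : (s : ℂ) = (i + 1 + k : ℕ) := by
        push_cast
        linear_combination -h0
      exact_mod_cast this.symm
  · intro i hi
    rcases Nat.eq_zero_or_pos i with rfl | hi0
    · exact ⟨p, hsum ▸ Submodule.sum_mem _ fun j _ => Submodule.subset_span ⟨j, rfl⟩, hp0, hpe⟩
    · obtain ⟨j, rfl⟩ : ∃ j, i = j + 1 := ⟨i - 1, by omega⟩
      have hlt := h.lt j (by omega)
      have hadd := h.add (j + 1) hi
      -- The last nonzero coefficient of a finite block sits just below the gap that precedes `d (j
      -- + 1)`; adding `k + 1` gives the degree `e (j + 1)`.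
      have hne : (g (d j) (d (j + 1))).coeff (d (j + 1) - lam (j + 1) - 1) ≠ 0 := by
        rw [hgc, if_pos (Finset.mem_Ico.2 (by omega)), Ne, hc0]
        exact h.gapPoly_eval_ne_zero (j := j) (by omega) (by omega) fun _ => by omega
      have hg0 : g (d j) (d (j + 1)) ≠ 0 := fun h0 => hne (by rw [h0, coeff_zero])
      have hdeg : (g (d j) (d (j + 1))).natDegree = d (j + 1) - lam (j + 1) - 1 := by
        refine le_antisymm ?_ (le_natDegree_of_ne_zero hne)
        rw [natDegree_le_iff_coeff_eq_zero]
        intro n hn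
        rw [hgc]
        split_ifs with hmem
        · rw [Finset.mem_Ico] at hmem
          rw [hc0, gapPoly_eval_natCast_eq_zero_iff]
          exact ⟨j + 1, hi, d (j + 1) - n - 1, by omega, by omega⟩
        · rfl
      refine ⟨w ⟨j, by omega⟩, Submodule.subset_span ⟨_, rfl⟩, ?_, ?_⟩
      · exact (hblock.rootMultiplicity_zero _).1
      · rw [hwlt _ (by simpa using (by omega : j < r)), natDegree_one_sub_X_pow_mul hg0, hdeg]
        omega

/-- For `j < r` the quotient `w j / (1 - x)^(k + 1)` is a polynomial of degree less than
`d (j + 1) - lam (j + 1)`, and `∑ w j` has degree at most `e 0`. -/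
structure IsFrameV {r : ℕ} (k : ℕ) (d e : ℕ → ℕ) (w : Fin (r + 1) → ℂ[X]) : Prop where
  block : IsBlockFamily (k + 1) d w
  dvd : ∀ j : Fin (r + 1), (j : ℕ) < r → (1 - X) ^ (k + 1) ∣ w j
  natDegree_le : ∀ j : Fin (r + 1), (j : ℕ) < r → (w j).natDegree ≤ e (j + 1)
  natDegree_sum_le : (∑ j, w j).natDegree ≤ e 0

section

variable {r k : ℕ} {d lam e : ℕ → ℕ} {w w' : Fin (r + 1) → ℂ[X]}

theorem divCoeff_sum_eq_zero_of_gap (h : IsGapped r k d lam e)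
    (hw : IsBlockFamily (k + 1) d w)
    (hdvd : ∀ j : Fin (r + 1), (j : ℕ) < r → (1 - X) ^ (k + 1) ∣ w j)
    (hdeg : ∀ j : Fin (r + 1), (j : ℕ) < r → (w j).natDegree ≤ e (j + 1))
    (c : Fin (r + 1) → ℂ) (i : ℕ) (hi : i ≤ r) (t : ℕ) (ht : t < lam i) (n : ℕ)
    (hn : n + (t + 1) = d i) : divCoeff (k + 1) n (∑ j, c j • w j) = 0 := by
  have hi0 : i ≠ 0 := by
    rintro rfl
    rw [h.zero] at hn
    omega
  obtain ⟨q, rfl⟩ : ∃ q, i = q + 1 := ⟨i - 1, by omega⟩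
  have hlt := h.lt q (by omega)
  have hadd := h.add (q + 1) hi
  have hb : InBlock r d ((⟨q, by omega⟩ : Fin (r + 1)) : ℕ) n :=
    ⟨by simp only; omega, fun _ => by simp only; omega⟩
  rw [hw.divCoeff_sum h.strictMono c hb, divCoeff_eq_zero_of_natDegree_lt (hdvd _ (by simp; omega))
    ((hdeg _ (by simp; omega)).trans_lt _), mul_zero]
  simp only
  omega

namespace IsFrameV

theorem sum_ne_zero (hw : IsFrameV k d e w) (hd : StrictMono d) : ∑ j, w j ≠ 0 := by
  intro h0
  have := Fintype.linearIndependent_iff.1 (hw.block.linearIndependent hd) (fun _ => 1)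
    (by simpa using h0) 0
  exact one_ne_zero this

/-- If `c_r ≠ 0`, then `w r` and hence `∑ w j` would be divisible by `(1 - X)^(k + 1)`, although `∑
w j` is nonzero of degree at most `e 0 ≤ k`. -/
theorem dvd_sum_iff (hw : IsFrameV k d e w) (h : IsGapped r k d lam e) (c : Fin (r + 1) → ℂ) :
    (X - C 1) ^ (k + 1) ∣ ∑ j, c j • w j ↔ c (Fin.last r) = 0 := by
  rw [← one_sub_X_pow_dvd_iff, Fin.sum_univ_castSucc]
  have h1 : (1 - X) ^ (k + 1) ∣ ∑ j : Fin r, w j.castSucc :=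
    Finset.dvd_sum fun j _ => hw.dvd _ (by simp)
  have h2 : (1 - X) ^ (k + 1) ∣ ∑ j : Fin r, c j.castSucc • w j.castSucc :=
    Finset.dvd_sum fun j _ => dvd_smul_of_dvd _ (hw.dvd _ (by simp))
  rw [dvd_add_right h2]
  constructor
  · intro h3
    by_contra hc
    have h4 := dvd_smul_of_dvd (c (Fin.last r))⁻¹ h3
    rw [smul_smul, inv_mul_cancel₀ hc, one_smul] at h4
    have h5 := dvd_add h1 h4
    rw [← Fin.sum_univ_castSucc] at h5
    obtain ⟨g, hg⟩ := h5
    have h6 := hw.natDegree_sum_le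
    have h7 := hw.sum_ne_zero h.strictMono
    have h8 : g ≠ 0 := by
      rintro rfl
      exact h7 (by rw [hg, mul_zero])
    rw [hg, natDegree_one_sub_X_pow_mul h8] at h6
    have := h.e_zero
    omega
  · intro hc
    rw [hc, zero_smul]
    exact dvd_zero _

theorem degree_sum_le_iff (hw : IsFrameV k d e w) (h : IsGapped r k d lam e)
    (c : Fin (r + 1) → ℂ) {i : ℕ} (hi : i ≤ r) :
    (∑ j, c j • w j).natDegree ≤ e i ↔ ∀ j : Fin (r + 1), i ≤ j → c j = c (Fin.last r) := by
  -- Subtracting `c_r ∑ w j`, which has degree at most `e 0`, leaves a multiple of `(1 - X)^(k +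
  -- 1)`. Degree at most `e i ≤ d i + k` then leaves no coefficient of the quotient at or beyond `d
  -- i`.
  have hsplit : ∑ j, c j • w j =
      ∑ j, (c j - c (Fin.last r)) • w j + c (Fin.last r) • ∑ j, w j := by
    simp only [sub_smul, Finset.sum_sub_distrib, Finset.smul_sum, sub_add_cancel]
  have hp : (c (Fin.last r) • ∑ j, w j).natDegree ≤ e i :=
    (natDegree_smul_le _ _).trans (hw.natDegree_sum_le.trans
      (h.strictMonoOn.monotoneOn (Nat.zero_le r) hi (Nat.zero_le i)))
  constructor
  · intro hdeg j hj
    by_cases hjr : (j : ℕ) < r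
    · have hy : (∑ j, (c j - c (Fin.last r)) • w j).natDegree ≤ e i := by
        rw [← sub_eq_iff_eq_add.2 hsplit]
        exact (natDegree_sub_le _ _).trans (max_le hdeg hp)
      have hdvd : (1 - X) ^ (k + 1) ∣ ∑ j, (c j - c (Fin.last r)) • w j :=
        one_sub_X_pow_dvd_iff.2 ((hw.dvd_sum_iff h _).2 (sub_self _))
      have h1 := hw.block.divCoeff_sum h.strictMono (fun j => c j - c (Fin.last r))
        (inBlock_self r h.strictMono j)
      have h2 := h.add i hi
      have h3 := h.strictMono.monotone hj
      rw [divCoeff_eq_zero_of_natDegree_lt hdvd (by omega)] at h1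
      exact sub_eq_zero.1 ((mul_eq_zero.1 h1.symm).resolve_right (hw.block.ne_zero j))
    · rw [show j = Fin.last r from Fin.ext (by simp; omega)]
  · intro hc
    rw [hsplit]
    refine (natDegree_add_le _ _).trans (max_le (natDegree_sum_le_of_forall_le _ _ fun j _ => ?_) hp)
    by_cases hj : i ≤ j
    · rw [hc j hj, sub_self, zero_smul, natDegree_zero]
      exact Nat.zero_le _
    · exact (natDegree_smul_le _ _).trans ((hw.natDegree_le j (by omega)).trans
        (h.strictMonoOn.monotoneOn (show (j : ℕ) + 1 ≤ r by omega) hi (by omega)))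

theorem exists_divCoeff_eq (hw : IsFrameV k d e w) (h : IsGapped r k d lam e) :
    ∃ a : ℂ, (∀ n, divCoeff (k + 1) n (∑ j, w j) = a * (gapPoly r d lam).eval (n : ℂ)) ∧ a ≠ 0 := by
  obtain ⟨a, h1, h2⟩ := h.divCoeff_eq_gapPoly hw.natDegree_sum_le (by
    simpa using divCoeff_sum_eq_zero_of_gap h hw.block hw.dvd hw.natDegree_le fun _ => 1)
  exact ⟨a, h1, h2 (hw.sum_ne_zero h.strictMono)⟩

theorem eq_smul (hw : IsFrameV k d e w) (hw' : IsFrameV k d e w')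
    (h : IsGapped r k d lam e) : ∃ c : ℂ, c ≠ 0 ∧ w' = fun j => c • w j := by
  obtain ⟨a, ha, ha0⟩ := hw.exists_divCoeff_eq h
  obtain ⟨a', ha', ha0'⟩ := hw'.exists_divCoeff_eq h
  have hc0 : a' / a ≠ 0 := div_ne_zero ha0' ha0
  refine ⟨a' / a, hc0, hw'.block.eq_of_sum_eq (hw.block.smul fun _ => hc0) h.strictMono ?_⟩
  rw [← Finset.smul_sum]
  refine eq_of_divCoeff_eq (κ := k + 1) fun n => ?_
  rw [map_smul, ha, ha', smul_eq_mul, ← mul_assoc, div_mul_cancel₀ _ ha0]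

end IsFrameV

end

theorem exists_isFrameV {r k : ℕ} {n₀ : Fin r → ℕ} {lam e : ℕ → ℕ}
    (h : IsGapped r k (expo n₀) lam e) {V : Submodule ℂ ℂ[X]}
    (hV : IsTwoPointSpace r n₀ (firstK r k) e V) :
    ∃ w : Fin (r + 1) → ℂ[X], IsFrameV k (expo n₀) e w ∧ ∀ j, w j ∈ V := by
  have := hV.finite
  have hd := h.strictMono
  -- For `j < r`: `j` conditions at 0, one at 1, and `r - j - 1` on the degree. For `j = r` all
  -- conditions are at 0.
  have hx : ∀ j : Fin (r + 1), ∃ x ∈ V, x ≠ 0 ∧ ∀ t : Fin r,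
      (if (t : ℕ) = j then leval 1 else
        lcoeff ℂ (if (t : ℕ) < j then expo n₀ t else e (t + 1))) x = 0 := fun j =>
    exists_ne_zero_of_functionals V (by simp [hV.finrank_eq]) fun t : Fin r =>
      if (t : ℕ) = j then leval 1 else
        lcoeff ℂ (if (t : ℕ) < j then expo n₀ t else e (t + 1))
  choose x hxV hx0 hxt using hx
  have hX : ∀ j : Fin (r + 1), X ^ expo n₀ j ∣ x j := by
    intro j
    refine X_pow_dvd_of_coeff_eq_zero hd hV.exponents_zero (hxV j) (hx0 j) fun t ht => ?_
    have := hxt j ⟨t, by omega⟩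
    simpa [ht, ht.ne] using this
  have hdeg : ∀ j : Fin (r + 1), (j : ℕ) < r → (x j).natDegree ≤ e (j + 1) := by
    intro j hj
    refine natDegree_le_of_coeff_eq_zero h.strictMonoOn.monotoneOn hV.exponents_infty (hxV j)
      (hx0 j) hj fun t ht htr => ?_
    have := hxt j ⟨t - 1, by omega⟩
    simp only at this
    rw [if_neg (by omega), if_neg (by omega), Nat.sub_add_cancel (by omega)] at this
    exact this
  -- Vanishing at 1 already means vanishing to order `k + 1`, since the exponents at 1 jump from 0
  -- to `k + 1`.
  have hdvd : ∀ j : Fin (r + 1), (j : ℕ) < r → (1 - X) ^ (k + 1) ∣ x j := by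
    intro j hj
    have h1 := hxt j ⟨j, hj⟩
    simp only [if_true] at h1
    have h2 := (rootMultiplicity_pos (hx0 j)).2 h1
    obtain ⟨t, ht, ht'⟩ : (x j).rootMultiplicity 1 ∈ expo (firstK r k) '' Set.Iic r :=
      hV.exponents_one ▸ ⟨x j, hxV j, hx0 j, rfl⟩
    rw [one_sub_X_pow_dvd_iff]
    refine (le_rootMultiplicity_iff (hx0 j)).1 ?_
    rcases Nat.eq_zero_or_pos t with rfl | ht0
    · rw [expo_zero] at ht'
      omega
    · rw [expo_firstK ht0 ht] at ht'
      omega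
  have hblock : IsBlockFamily (k + 1) (expo n₀) x := by
    refine IsBlockFamily.of_support hd hV.exponents_zero hxV hx0 fun j n hn => ?_
    have hle : expo n₀ j ≤ n := by
      by_contra! hlt
      exact hn (X_pow_dvd_iff_divCoeff.1 (hX j) n hlt)
    refine ⟨hle, fun hj => ?_⟩
    by_contra! hlt
    refine hn (divCoeff_eq_zero_of_natDegree_lt (hdvd j hj) ((hdeg j hj).trans_lt ?_))
    have := h.add (j + 1) hj
    omega
  obtain ⟨p, hpV, hp0, hp⟩ : e 0 ∈ exponentsAtInfty V := by
    rw [hV.exponents_infty]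
    exact ⟨0, by simp, rfl⟩
  obtain ⟨c, rfl⟩ := hblock.exists_sum_eq hd hV.finrank_eq hxV hpV
  obtain ⟨a, ha, ha0⟩ := h.divCoeff_eq_gapPoly hp.le
    (divCoeff_sum_eq_zero_of_gap h hblock hdvd hdeg c)
  -- The coefficient of `p / (1 - x)^(k + 1)` at `d j` is a nonzero multiple of the value of
  -- `gapPoly` there, and `d j` is not a gap point.
  have hc : ∀ j, c j ≠ 0 := by
    intro j hcj
    have := hblock.divCoeff_sum hd c (inBlock_self r hd j)
    rw [ha, hcj, zero_mul] at this
    exact mul_ne_zero (ha0 hp0) (h.gapPoly_eval_left (by omega)) this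
  exact ⟨fun j => c j • x j, ⟨hblock.smul hc, fun j hj => dvd_smul_of_dvd _ (hdvd j hj),
    fun j hj => (natDegree_smul_le _ _).trans (hdeg j hj), hp.le⟩, fun j => V.smul_mem _ (hxV j)⟩

/-! ### Consistent parameters -/

theorem Consistent.extL_succ_le {r : ℕ} {m l : Fin r → ℕ} {k : ℕ} (h : Consistent m l k) (s : ℕ) :
    extL l k (s + 1) ≤ extL l k s := by
  by_cases hs : s < r
  · exact h.1 ⟨s, hs⟩
  · rw [extL, dif_neg hs]
    exact Nat.zero_le _

theorem Consistent.sum_range {r : ℕ} {m l : Fin r → ℕ} {k : ℕ} (h : Consistent m l k) :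
    ∑ i ∈ Finset.range (r + 1), (extL l k i - extL l k (i + 1)) = k := by
  have key : ∀ n, ∑ i ∈ Finset.range n, (extL l k i - extL l k (i + 1)) + extL l k n = k := by
    intro n
    induction n with
    | zero => simp [extL]
    | succ n ih =>
      have := h.extL_succ_le n
      rw [Finset.sum_range_succ]
      omega
  have h1 := key (r + 1)
  rwa [extL, dif_neg (lt_irrefl r), add_zero] at h1

theorem Consistent.isInterlacing {r : ℕ} {m l : Fin r → ℕ} {k : ℕ} (h : Consistent m l k) :
    IsInterlacing r k (expo (revM m)) (degU m l k) where
  strictMono := expo_strictMono _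
  zero := expo_zero _
  le i _ := Nat.le_add_right _ _
  lt i hi := by
    have h1 := expo_succ (revM m) ⟨i, hi⟩
    have h2 := h.2 ⟨r - (i + 1), by omega⟩
    have h3 : revM m ⟨i, hi⟩ = m ⟨r - (i + 1), by omega⟩ := rfl
    simp only at h1 h2
    rw [h1, h3, degU]
    rw [show r - (i + 1) + 1 = r - i by omega, show r - (i + 1) + 2 = r - i + 1 by omega] at h2
    omega
  sum := by
    have h1 := h.sum_range
    rw [← Finset.sum_range_reflect] at h1
    simp only [degU, Finset.sum_add_distrib, Nat.add_sub_cancel] at h1 ⊢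
    rw [h1]

theorem Consistent.isGapped {r : ℕ} {m l : Fin r → ℕ} {k : ℕ} (h : Consistent m l k) :
    IsGapped r k (expo m) (fun i => extL l k i - extL l k (i + 1)) (degV m l k) where
  strictMono := expo_strictMono _
  zero := expo_zero _
  lt i hi := by
    have h1 := expo_succ m ⟨i, hi⟩
    have h2 := h.2 ⟨i, hi⟩
    simp only [add_assoc, Nat.reduceAdd] at h1 h2 ⊢
    omega
  sum := h.sum_range
  add i _ := by
    have h1 := h.extL_succ_le i
    have h2 : extL l k i ≤ k := by
      have := antitone_nat_of_succ_le h.extL_succ_le (Nat.zero_le i)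
      exact this
    rw [degV]
    omega

/-! ### Canonical maps -/

section Coordinates

variable {r : ℕ} {V₁ V₂ : Type*} [AddCommGroup V₁] [Module ℂ V₁] [AddCommGroup V₂] [Module ℂ V₂]
  (b₁ : Module.Basis (Fin (r + 1)) ℂ V₁) (b₂ : Module.Basis (Fin (r + 1)) ℂ V₂)

theorem map_equiv_eq_of_repr {F₁ : Submodule ℂ V₁} {F₂ : Submodule ℂ V₂}
    (Φ : (Fin (r + 1) → ℂ) → Prop) (h₁ : ∀ x, x ∈ F₁ ↔ Φ (b₁.repr x))
    (h₂ : ∀ x, x ∈ F₂ ↔ Φ (b₂.repr x)) :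
    F₁.map (b₁.equiv b₂ (Equiv.refl _)).toLinearMap = F₂ := by
  have key : ∀ x, (b₂.repr (b₁.equiv b₂ (Equiv.refl _) x) : Fin (r + 1) → ℂ) = b₁.repr x := by
    intro x
    simp [Module.Basis.equiv]
  ext y
  rw [Submodule.mem_map, h₂]
  constructor
  · rintro ⟨x, hx, rfl⟩
    rw [LinearEquiv.coe_coe, key]
    exact (h₁ x).1 hx
  · intro hy
    refine ⟨(b₁.equiv b₂ (Equiv.refl _)).symm y, ?_, LinearEquiv.apply_symm_apply _ y⟩
    rw [h₁, ← key, LinearEquiv.apply_symm_apply]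
    exact hy

theorem repr_mem_of_map_eq {F₁ : Submodule ℂ V₁} {F₂ : Submodule ℂ V₂} {a : V₁ →ₗ[ℂ] V₂}
    (hF : F₁.map a = F₂) {Φ : (Fin (r + 1) → ℂ) → Prop}
    (h₁ : ∀ x, x ∈ F₁ ↔ Φ (b₁.repr x)) (h₂ : ∀ x, x ∈ F₂ ↔ Φ (b₂.repr x)) {x : V₁}
    (hx : Φ (b₁.repr x)) : Φ (b₂.repr (a x)) := by
  rw [← h₂, ← hF]
  exact Submodule.mem_map_of_mem ((h₁ x).2 hx)

/-- A diagonal matrix whose diagonal entries, read off from the image of `∑ b₁ t`, all agree is a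
scalar. -/
theorem eq_smul_equiv {a : V₁ →ₗ[ℂ] V₂} (ha : Function.Injective a)
    (hdiag : ∀ i j, i ≠ j → b₂.repr (a (b₁ j)) i = 0)
    (hsum : ∀ i j, b₂.repr (a (∑ t, b₁ t)) i = b₂.repr (a (∑ t, b₁ t)) j) :
    ∃ c : ℂ, c ≠ 0 ∧ a = c • (b₁.equiv b₂ (Equiv.refl _)).toLinearMap := by
  have h1 : ∀ i, b₂.repr (a (∑ t, b₁ t)) i = b₂.repr (a (b₁ i)) i := by
    intro i
    rw [map_sum, map_sum, Finsupp.finsetSum_apply, Finset.sum_eq_single i]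
    · exact fun j _ hj => hdiag i j hj.symm
    · simp
  set c := b₂.repr (a (∑ t, b₁ t)) 0 with hc
  have h2 : ∀ j, a (b₁ j) = c • b₂ j := by
    intro j
    refine b₂.ext_elem fun i => ?_
    rw [map_smul, Finsupp.smul_apply, b₂.repr_self_apply, smul_eq_mul]
    split_ifs with hij
    · rw [← hij, ← h1, mul_one, hsum j 0]
    · rw [hdiag i j (Ne.symm hij), mul_zero]
  refine ⟨c, fun h0 => ?_, b₁.ext fun j => ?_⟩
  · have h3 := h2 0
    rw [h0, zero_smul, ← map_zero a] at h3
    exact b₁.ne_zero 0 (ha h3)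
  · rw [h2]
    simp

theorem eq_smul_of_eq_smul_equiv {a a' f : V₁ →ₗ[ℂ] V₂} (h : ∃ c : ℂ, c ≠ 0 ∧ a = c • f)
    (h' : ∃ c : ℂ, c ≠ 0 ∧ a' = c • f) : ∃ c : ℂ, c ≠ 0 ∧ a' = c • a := by
  obtain ⟨c, hc, rfl⟩ := h
  obtain ⟨c', hc', rfl⟩ := h'
  exact ⟨c' / c, div_ne_zero hc' hc, by rw [smul_smul, div_mul_cancel₀ _ hc]⟩

end Coordinates

/-! ### The flags in frame coordinates -/

theorem mem_flagAt {r : ℕ} {V : Submodule ℂ ℂ[X]} {z : ℂ} {n : Fin r → ℕ} {i : ℕ} {x : V} :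
    x ∈ flagAt V z n i ↔ (X - C z) ^ expo n (r + 1 - i) ∣ (x : ℂ[X]) := by
  rw [flagAt, Submodule.mem_comap, Submodule.restrictScalars_mem, Ideal.mem_span_singleton]
  rfl

theorem mem_flagAtInfty {V : Submodule ℂ ℂ[X]} {e : ℕ → ℕ} {i : ℕ} {x : V} :
    x ∈ flagAtInfty V e i ↔ (x : ℂ[X]).natDegree ≤ e (i - 1) := by
  rw [flagAtInfty, Submodule.mem_comap, mem_degreeLE, ← natDegree_le_iff_degree_le]
  rfl

theorem coe_eq_sum_repr {r : ℕ} {V : Submodule ℂ ℂ[X]} {w : Fin (r + 1) → ℂ[X]}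
    {b : Module.Basis (Fin (r + 1)) ℂ V} (hb : ∀ j, (b j : ℂ[X]) = w j) (x : V) :
    (x : ℂ[X]) = ∑ j, b.repr x j • w j := by
  conv_lhs => rw [← b.sum_repr x]
  rw [Submodule.coe_sum]
  exact Finset.sum_congr rfl fun j _ => by rw [Submodule.coe_smul, hb]

theorem IsBlockFamily.mem_flagAt_zero_iff {r κ : ℕ} {n : Fin r → ℕ} {w : Fin (r + 1) → ℂ[X]}
    (hw : IsBlockFamily κ (expo n) w) {V : Submodule ℂ ℂ[X]}
    {b : Module.Basis (Fin (r + 1)) ℂ V} (hb : ∀ j, (b j : ℂ[X]) = w j) (i : ℕ) (x : V) :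
    x ∈ flagAt V 0 n i ↔ ∀ j : Fin (r + 1), (j : ℕ) < r + 1 - i → b.repr x j = 0 := by
  rw [mem_flagAt, map_zero, sub_zero, coe_eq_sum_repr hb,
    hw.X_pow_dvd_sum_iff (expo_strictMono n)]

section

variable {r : ℕ} {m l₁ l₂ : Fin r → ℕ} {k₁ k₂ : ℕ}

theorem sum_basis_repr {V : Type*} [AddCommGroup V] [Module ℂ V]
    (b : Module.Basis (Fin (r + 1)) ℂ V) (i : Fin (r + 1)) : b.repr (∑ t, b t) i = 1 := by
  simp [Finsupp.single_apply]

theorem canonicalU (hr : 0 < r) (h₁ : Consistent m l₁ k₁) (h₂ : Consistent m l₂ k₂)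
    {U₁ U₂ : Submodule ℂ ℂ[X]} (hU₁ : IsSpaceU m l₁ k₁ U₁) (hU₂ : IsSpaceU m l₂ k₂ U₂) :
    (∃ b : U₁ →ₗ[ℂ] U₂, IsCanonicalU m l₁ k₁ l₂ k₂ b) ∧
      ∀ b b' : U₁ →ₗ[ℂ] U₂, IsCanonicalU m l₁ k₁ l₂ k₂ b →
        IsCanonicalU m l₁ k₁ l₂ k₂ b' → ∃ c : ℂ, c ≠ 0 ∧ b' = c • b := by
  have coord : ∀ (l : Fin r → ℕ) (k : ℕ) (U : Submodule ℂ ℂ[X]), Consistent m l k →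
      IsSpaceU m l k U → ∃ b : Module.Basis (Fin (r + 1)) ℂ U,
        (∀ i x, x ∈ flagAt U 0 (revM m) i ↔
          ∀ j : Fin (r + 1), (j : ℕ) < r + 1 - i → b.repr x j = 0) ∧
        (∀ i ∈ Finset.Icc 1 r, ∀ x, x ∈ flagAtInfty U (degU m l k) i ↔
          ∀ j : Fin (r + 1), i - 1 < j → b.repr x j = 0) ∧
        ∀ x, x ∈ flagAt U 1 (lastK r k) 1 ↔ ∀ i j, b.repr x i = b.repr x j := by
    intro l k U h hU
    obtain ⟨w, hw, hmem⟩ := exists_isFrameU hr h.isInterlacing hU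
    obtain ⟨b, hb⟩ := hw.block.exists_basis (expo_strictMono _) hU.finrank_eq hmem
    refine ⟨b, hw.block.mem_flagAt_zero_iff hb, fun i hi x => ?_, fun x => ?_⟩
    · rw [Finset.mem_Icc] at hi
      rw [mem_flagAtInfty, coe_eq_sum_repr hb, hw.degree_sum_le_iff h.isInterlacing _ (by omega)]
    · rw [mem_flagAt, Nat.add_sub_cancel, expo_lastK_self k hr, coe_eq_sum_repr hb,
        hw.dvd_sum_iff h.isInterlacing]
  obtain ⟨b₁, hz₁, hi₁, ho₁⟩ := coord l₁ k₁ U₁ h₁ hU₁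
  obtain ⟨b₂, hz₂, hi₂, ho₂⟩ := coord l₂ k₂ U₂ h₂ hU₂
  refine ⟨⟨(b₁.equiv b₂ (Equiv.refl _)).toLinearMap, (b₁.equiv b₂ (Equiv.refl _)).bijective,
    fun i _ => map_equiv_eq_of_repr b₁ b₂
      (fun c => ∀ j : Fin (r + 1), (j : ℕ) < r + 1 - i → c j = 0) (hz₁ i) (hz₂ i),
    fun i hi => map_equiv_eq_of_repr b₁ b₂
      (fun c => ∀ j : Fin (r + 1), i - 1 < j → c j = 0) (hi₁ i hi) (hi₂ i hi),
    map_equiv_eq_of_repr b₁ b₂ (fun c => ∀ i j, c i = c j) ho₁ ho₂⟩, ?_⟩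
  have huniq : ∀ a : U₁ →ₗ[ℂ] U₂, IsCanonicalU m l₁ k₁ l₂ k₂ a →
      ∃ c : ℂ, c ≠ 0 ∧ a = c • (b₁.equiv b₂ (Equiv.refl _)).toLinearMap := by
    intro a ha
    refine eq_smul_equiv b₁ b₂ ha.bijective.injective (fun i j hij => ?_) ?_
    -- The flags at 0 and at infinity are opposite, so preserving both makes the matrix diagonal;
    -- the line at 1 makes it scalar.
    · rcases lt_or_gt_of_ne hij with hlt | hlt
      · have hlt' : (i : ℕ) < j := hlt
        refine repr_mem_of_map_eq b₁ b₂ (ha.map_zero (r + 1 - j) (Finset.mem_Icc.2 (by omega)))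
          (Φ := fun c => ∀ t : Fin (r + 1), (t : ℕ) < r + 1 - (r + 1 - j) → c t = 0)
          (hz₁ _) (hz₂ _) (fun t ht => ?_) i (by omega)
        rw [b₁.repr_self_apply, if_neg]
        rintro rfl
        omega
      · have hlt' : (j : ℕ) < i := hlt
        have hmem : (j : ℕ) + 1 ∈ Finset.Icc 1 r := Finset.mem_Icc.2 (by omega)
        refine repr_mem_of_map_eq b₁ b₂ (ha.map_infty (j + 1) hmem)
          (Φ := fun c => ∀ t : Fin (r + 1), (j : ℕ) + 1 - 1 < t → c t = 0)
          (hi₁ _ hmem) (hi₂ _ hmem) (fun t ht => ?_) i (by omega)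
        rw [b₁.repr_self_apply, if_neg]
        rintro rfl
        omega
    · refine repr_mem_of_map_eq b₁ b₂ ha.map_one (Φ := fun c => ∀ i j, c i = c j) ho₁ ho₂ ?_
      intro i j
      rw [sum_basis_repr, sum_basis_repr]
  exact fun b b' hb hb' => eq_smul_of_eq_smul_equiv (huniq b hb) (huniq b' hb')

theorem canonicalV (hr : 0 < r) (h₁ : Consistent m l₁ k₁) (h₂ : Consistent m l₂ k₂)
    {V₁ V₂ : Submodule ℂ ℂ[X]} (hV₁ : IsSpaceV m l₁ k₁ V₁) (hV₂ : IsSpaceV m l₂ k₂ V₂) :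
    (∃ a : V₁ →ₗ[ℂ] V₂, IsCanonicalV m l₁ k₁ l₂ k₂ a) ∧
      ∀ a a' : V₁ →ₗ[ℂ] V₂, IsCanonicalV m l₁ k₁ l₂ k₂ a →
        IsCanonicalV m l₁ k₁ l₂ k₂ a' → ∃ c : ℂ, c ≠ 0 ∧ a' = c • a := by
  have coord : ∀ (l : Fin r → ℕ) (k : ℕ) (V : Submodule ℂ ℂ[X]), Consistent m l k →
      IsSpaceV m l k V → ∃ b : Module.Basis (Fin (r + 1)) ℂ V,
        (∀ i x, x ∈ flagAt V 0 m i ↔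
          ∀ j : Fin (r + 1), (j : ℕ) < r + 1 - i → b.repr x j = 0) ∧
        (∀ i ∈ Finset.Icc 1 r, ∀ x, x ∈ flagAtInfty V (degV m l k) i ↔
          ∀ j : Fin (r + 1), i - 1 ≤ j → b.repr x j = b.repr x (Fin.last r)) ∧
        ∀ x, x ∈ flagAt V 1 (firstK r k) r ↔ b.repr x (Fin.last r) = 0 := by
    intro l k V h hV
    obtain ⟨w, hw, hmem⟩ := exists_isFrameV h.isGapped hV
    obtain ⟨b, hb⟩ := hw.block.exists_basis (expo_strictMono _) hV.finrank_eq hmem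
    refine ⟨b, hw.block.mem_flagAt_zero_iff hb, fun i hi x => ?_, fun x => ?_⟩
    · rw [Finset.mem_Icc] at hi
      rw [mem_flagAtInfty, coe_eq_sum_repr hb, hw.degree_sum_le_iff h.isGapped _ (by omega)]
    · rw [mem_flagAt, Nat.add_sub_cancel_left, expo_firstK Nat.one_pos hr, add_comm 1 k,
        coe_eq_sum_repr hb, hw.dvd_sum_iff h.isGapped]
  obtain ⟨b₁, hz₁, hi₁, ho₁⟩ := coord l₁ k₁ V₁ h₁ hV₁
  obtain ⟨b₂, hz₂, hi₂, ho₂⟩ := coord l₂ k₂ V₂ h₂ hV₂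
  refine ⟨⟨(b₁.equiv b₂ (Equiv.refl _)).toLinearMap, (b₁.equiv b₂ (Equiv.refl _)).bijective,
    fun i _ => map_equiv_eq_of_repr b₁ b₂
      (fun c => ∀ j : Fin (r + 1), (j : ℕ) < r + 1 - i → c j = 0) (hz₁ i) (hz₂ i),
    fun i hi => map_equiv_eq_of_repr b₁ b₂
      (fun c => ∀ j : Fin (r + 1), i - 1 ≤ j → c j = c (Fin.last r)) (hi₁ i hi) (hi₂ i hi),
    map_equiv_eq_of_repr b₁ b₂ (fun c => c (Fin.last r) = 0) ho₁ ho₂⟩, ?_⟩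
  have huniq : ∀ a : V₁ →ₗ[ℂ] V₂, IsCanonicalV m l₁ k₁ l₂ k₂ a →
      ∃ c : ℂ, c ≠ 0 ∧ a = c • (b₁.equiv b₂ (Equiv.refl _)).toLinearMap := by
    intro a ha
    refine eq_smul_equiv b₁ b₂ ha.bijective.injective (fun i j hij => ?_) ?_
    · rcases lt_or_gt_of_ne hij with hlt | hlt
      · have hlt' : (i : ℕ) < j := hlt
        refine repr_mem_of_map_eq b₁ b₂ (ha.map_zero (r + 1 - j) (Finset.mem_Icc.2 (by omega)))
          (Φ := fun c => ∀ t : Fin (r + 1), (t : ℕ) < r + 1 - (r + 1 - j) → c t = 0)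
          (hz₁ _) (hz₂ _) (fun t ht => ?_) i (by omega)
        rw [b₁.repr_self_apply, if_neg]
        rintro rfl
        omega
      · have hlt' : (j : ℕ) < i := hlt
        have hne : ∀ t : Fin (r + 1), (j : ℕ) < t → b₁.repr (b₁ j) t = 0 := by
          intro t ht
          rw [b₁.repr_self_apply, if_neg]
          rintro rfl
          omega
        have hjr : (j : ℕ) < Fin.last r := by
          rw [Fin.val_last]
          omega
        -- The condition for `F_(j+2)(∞)` only equates the coordinates after the `j`-th with the
        -- last one; the hyperplane at 1 makes that common value zero. For `j = r - 1` the
        -- hyperplane alone suffices.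
        have hlast : b₂.repr (a (b₁ j)) (Fin.last r) = 0 :=
          repr_mem_of_map_eq b₁ b₂ ha.map_one (Φ := fun c => c (Fin.last r) = 0) ho₁ ho₂
            (hne _ hjr)
        by_cases hjr2 : (j : ℕ) + 2 ≤ r
        · have hmem : (j : ℕ) + 2 ∈ Finset.Icc 1 r := Finset.mem_Icc.2 (by omega)
          rw [← hlast]
          refine repr_mem_of_map_eq b₁ b₂ (ha.map_infty (j + 2) hmem)
            (Φ := fun c => ∀ t : Fin (r + 1), (j : ℕ) + 2 - 1 ≤ t → c t = c (Fin.last r))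
            (hi₁ _ hmem) (hi₂ _ hmem) (fun t ht => ?_) i (by omega)
          rw [hne t (by omega), hne _ hjr]
        · rw [show i = Fin.last r from Fin.ext (by rw [Fin.val_last]; omega), hlast]
    -- The line `F_1(∞)`, spanned by the sum of the frame, plays the role that `F_1(1)` has for U.
    · have hmem : 1 ∈ Finset.Icc 1 r := Finset.mem_Icc.2 (by omega)
      have := repr_mem_of_map_eq b₁ b₂ (ha.map_infty 1 hmem)
        (Φ := fun c => ∀ t : Fin (r + 1), 1 - 1 ≤ (t : ℕ) → c t = c (Fin.last r))
        (hi₁ _ hmem) (hi₂ _ hmem) (x := ∑ t, b₁ t)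
        (fun t _ => by rw [sum_basis_repr, sum_basis_repr])
      exact fun i j => (this i (Nat.zero_le _)).trans (this j (Nat.zero_le _)).symm
  exact fun a a' ha ha' => eq_smul_of_eq_smul_equiv (huniq a ha) (huniq a' ha')

end

/-! ### Existence and uniqueness of the spaces -/

section

variable {r : ℕ} {m l : Fin r → ℕ} {k : ℕ}

theorem existsUnique_isSpaceU (hr : 0 < r) (h : Consistent m l k) :
    ∃! U : Submodule ℂ ℂ[X], IsSpaceU m l k U := by
  refine existsUnique_of_exists_of_unique
    (exists_isTwoPointSpace_lastK hr h.isInterlacing) fun U U' hU hU' => ?_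
  have := hU.finite
  have := hU'.finite
  obtain ⟨w, hw, hmem⟩ := exists_isFrameU hr h.isInterlacing hU
  obtain ⟨w', hw', hmem'⟩ := exists_isFrameU hr h.isInterlacing hU'
  obtain ⟨c, -, hc⟩ := hw.eq_smul hw' h.isInterlacing
  rw [← hw'.block.span_eq (expo_strictMono _) hU'.finrank_eq hmem',
    hw'.block.span_eq (expo_strictMono _) hU.finrank_eq fun j => hc ▸ U.smul_mem c (hmem j)]

theorem existsUnique_isSpaceV (h : Consistent m l k) :
    ∃! V : Submodule ℂ ℂ[X], IsSpaceV m l k V := by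
  refine existsUnique_of_exists_of_unique
    (exists_isTwoPointSpace_firstK h.isGapped) fun V V' hV hV' => ?_
  have := hV.finite
  have := hV'.finite
  obtain ⟨w, hw, hmem⟩ := exists_isFrameV h.isGapped hV
  obtain ⟨w', hw', hmem'⟩ := exists_isFrameV h.isGapped hV'
  obtain ⟨c, -, hc⟩ := hw.eq_smul hw' h.isGapped
  rw [← hw'.block.span_eq (expo_strictMono _) hV'.finrank_eq hmem',
    hw'.block.span_eq (expo_strictMono _) hV.finrank_eq fun j => hc ▸ V.smul_mem c (hmem j)]

end

end TwoPointSpaces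

theorem mainTheorem6 (r : ℕ) (hr : 0 < r) (m l₁ l₂ : Fin r → ℕ) (k₁ k₂ : ℕ)
    (h₁ : TwoPointSpaces.Consistent m l₁ k₁) (h₂ : TwoPointSpaces.Consistent m l₂ k₂) :
    ((∃! V : Submodule ℂ (Polynomial ℂ), TwoPointSpaces.IsSpaceV m l₁ k₁ V) ∧
      (∃! V : Submodule ℂ (Polynomial ℂ), TwoPointSpaces.IsSpaceV m l₂ k₂ V) ∧
      ∀ V₁ V₂ : Submodule ℂ (Polynomial ℂ),
        TwoPointSpaces.IsSpaceV m l₁ k₁ V₁ → TwoPointSpaces.IsSpaceV m l₂ k₂ V₂ →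
        (∃ a : V₁ →ₗ[ℂ] V₂, TwoPointSpaces.IsCanonicalV m l₁ k₁ l₂ k₂ a) ∧
        ∀ a a' : V₁ →ₗ[ℂ] V₂, TwoPointSpaces.IsCanonicalV m l₁ k₁ l₂ k₂ a →
          TwoPointSpaces.IsCanonicalV m l₁ k₁ l₂ k₂ a' → ∃ c : ℂ, c ≠ 0 ∧ a' = c • a) ∧
    ((∃! U : Submodule ℂ (Polynomial ℂ), TwoPointSpaces.IsSpaceU m l₁ k₁ U) ∧
      (∃! U : Submodule ℂ (Polynomial ℂ), TwoPointSpaces.IsSpaceU m l₂ k₂ U) ∧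
      ∀ U₁ U₂ : Submodule ℂ (Polynomial ℂ),
        TwoPointSpaces.IsSpaceU m l₁ k₁ U₁ → TwoPointSpaces.IsSpaceU m l₂ k₂ U₂ →
        (∃ b : U₁ →ₗ[ℂ] U₂, TwoPointSpaces.IsCanonicalU m l₁ k₁ l₂ k₂ b) ∧
        ∀ b b' : U₁ →ₗ[ℂ] U₂, TwoPointSpaces.IsCanonicalU m l₁ k₁ l₂ k₂ b →
          TwoPointSpaces.IsCanonicalU m l₁ k₁ l₂ k₂ b' → ∃ c : ℂ, c ≠ 0 ∧ b' = c • b) := by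
  open TwoPointSpaces in
  exact ⟨⟨existsUnique_isSpaceV h₁, existsUnique_isSpaceV h₂,
      fun _ _ hV₁ hV₂ => canonicalV hr h₁ h₂ hV₁ hV₂⟩,
    existsUnique_isSpaceU hr h₁, existsUnique_isSpaceU hr h₂,
      fun _ _ hU₁ hU₂ => canonicalU hr h₁ h₂ hU₁ hU₂⟩
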